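/- Let $n\ge 0$, $b>0$, $T>0$, $A\in\mathbb R^{n\times n}$ and $x_d\in L^2(0,T;\mathbb R^n)$. Let $f\colon\mathbb R^n\to\mathbb R^n$ be continuously differentiable and such that, for some $\lambda>0$, $\langle Df(y)v,v\rangle+\lambda|v|^2\ge 0$ for all $y,v\in\mathbb R^n$; let $\varphi\in H^1(-b,0;\mathbb R^n)$ and $g\in L^2(0,T;\mathbb R^n)$. ($H^1$ functions on an interval are identified with their continuous representatives.) For each $\tau\in[0,b]$ let $x[\tau]\in C([-b,T];\mathbb R^n)$, with $x[\tau]|_{[0,T]}\in H^1(0,T;\mathbb R^n)$, be the solution of $$\dot x(t)+f(x(t))=A\,x(t-\tau)+g(t)\ \text{ for a.e. } t\in(0,T),\qquad x(t)=\varphi(t)\ \text{ for } t\in[-b,0],$$ and let $p[\tau]\in H^1(0,T+b;\mathbb R^n)$ be the solution of the adjoint equation $$-\dot p(t)+Df(x[\tau](t))^\top p(t)=A^\top p(t+\tau)+x[\tau](t)-x_d(t)\ \text{ for a.e. } t\in(0,T),\qquad p(t)=0\ \text{ for } t\in[T,T+b].$$ These solutions exist and are unique. Moreover, the function $$j(\tau)=\frac12\int_0^T\big|x[\tau](t)-x_d(t)\big|^2\,dt$$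 belongs to $C^1[0,b]$ (with one-sided derivatives at the end points), and for every $\tau\in[0,b]$ $$j'(\tau)=-\int_0^T\big\langle p[\tau](t),\,A\,\dot x[\tau](t-\tau)\big\rangle\,dt .$$ -/

import Mathlib

open MeasureTheory Set

namespace DelayOpt

/-- `u` is (the absolutely continuous representative of) an element of `H¹(a,b;ℝⁿ)`:
it is absolutely continuous on `[a,b]`, differentiable almost everywhere there, and its derivative
is square integrable. The derivative is then the weak derivative of `u`. -/
def IsH1 {n : ℕ} (a b : ℝ) (u : ℝ → EuclideanSpace ℝ (Fin n)) : Prop :=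
  AbsolutelyContinuousOnInterval u a b ∧
    (∀ᵐ t ∂(volume.restrict (Ioo a b)), DifferentiableAt ℝ u t) ∧
    MemLp (deriv u) 2 (volume.restrict (Ioo a b))

/-- `x` is a solution on `[-b,T]` of the delay equation
`ẋ(t) + f(x(t)) = A x(t-τ) + g(t)` in `(0,T)`, `x = φ` on `[-b,0]`. Values of `x` outside
`[-b,T]` are irrelevant. -/
structure IsState {n : ℕ} (b T : ℝ) (A : Matrix (Fin n) (Fin n) ℝ)
    (f : EuclideanSpace ℝ (Fin n) → EuclideanSpace ℝ (Fin n))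
    (g φ : ℝ → EuclideanSpace ℝ (Fin n)) (τ : ℝ)
    (x : ℝ → EuclideanSpace ℝ (Fin n)) : Prop where
  continuousOn : ContinuousOn x (Icc (-b) T)
  isH1 : IsH1 0 T x
  initial : ∀ t ∈ Icc (-b) 0, x t = φ t
  equation : ∀ᵐ t ∂(volume.restrict (Ioo 0 T)),
    deriv x t + f (x t) = Matrix.toEuclideanCLM (𝕜 := ℝ) A (x (t - τ)) + g t

/-- `p` is a solution on `[0,T+b]` of the adjoint equation associated with the state `x`,
`-ṗ(t) + Df(x(t))ᵀ p(t) = Aᵀ p(t+τ) + x(t) - x_d(t)` in `(0,T)`, `p = 0` on `[T,T+b]`. -/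
structure IsAdjointState {n : ℕ} (b T : ℝ) (A : Matrix (Fin n) (Fin n) ℝ)
    (f : EuclideanSpace ℝ (Fin n) → EuclideanSpace ℝ (Fin n))
    (xd : ℝ → EuclideanSpace ℝ (Fin n)) (τ : ℝ)
    (x p : ℝ → EuclideanSpace ℝ (Fin n)) : Prop where
  isH1 : IsH1 0 (T + b) p
  terminal : ∀ t ∈ Icc T (T + b), p t = 0
  equation : ∀ᵐ t ∂(volume.restrict (Ioo 0 T)),
    -deriv p t + ContinuousLinearMap.adjoint (fderiv ℝ f (x t)) (p t) =
      Matrix.toEuclideanCLM (𝕜 := ℝ) A.transpose (p (t + τ)) + x t - xd t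

/-- The cost `j(τ) = ½ ∫₀ᵀ |x[τ](t) - x_d(t)|² dt` of a family of states `τ ↦ x[τ]`. -/
noncomputable def cost {n : ℕ} (T : ℝ) (xd : ℝ → EuclideanSpace ℝ (Fin n))
    (x : ℝ → ℝ → EuclideanSpace ℝ (Fin n)) (τ : ℝ) : ℝ :=
  (1 / 2) * ∫ t in (0 : ℝ)..T, ‖x τ t - xd t‖ ^ 2

end DelayOpt

/-!
The state need not be differentiable in the delay for the cost to be: Lipschitz dependence is
enough, because the adjoint state does the linearization.

*Differentiability.* Let `x`, `y` be the states for the delays `τ`, `σ`, let `z = y - x` and let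
`p` be the adjoint state at `τ`. Grönwall's inequality and the fact that a function with integrable
derivative moves by `O(|σ - τ|)` in `L¹` under translations give `z = O(|σ - τ|)` uniformly in time
(`IsLineState.norm_sub_le`). Testing the adjoint equation with `z` and integrating by parts
(`IsLineAdjoint.integral_inner_sub`) yields an exact formula for `j(σ) - j(τ)`
(`half_integral_norm_sq_sub`): it equals `k(σ) - k(τ)` with `k(r) = ∫ ⟨p(t), A x(t - r)⟩ dt`, plus
the linearization error of `f`, plus `½ ∫ |z|²`, plus `∫ ⟨p(t + σ) - p(t + τ), A z(t)⟩ dt`. The last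
three are `o(|σ - τ|)`, the first because the derivative of `f` is uniformly continuous on bounded
sets, the other two because they are quadratic in `|σ - τ|`. By Fubini's theorem `k` is a primitive
of `-∫ ⟨p(t), A x'(t - r)⟩ dt`, which is continuous in `r`
(`hasDerivAt_integral_inner_translate`), and this gives the formula for `j'`. It is continuous in
`τ`, since `x'` depends continuously on `τ` in `L¹` and `p` does uniformly
(`continuousOn_integral_inner_velocity`).

*Solvability.* The one-sided bound on the derivative of `f` gives an energy estimate that is uniform
in the delay and survives cutting off `f` (`norm_sq_le_of_delay_equation`). The cut-off equation is
globally Lipschitz and is solved by a contraction in a weighted sup norm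
(`exists_delay_solution`). The adjoint equation becomes a linear delay equation when time is
reversed. Uniqueness is the case `σ = τ` of the stability estimates.

States and adjoint states are extended by constants to the whole line, so that translations cost
nothing at the end points.
-/

namespace DelayOpt

/-! ### Primitives of integrable functions, absolute continuity and `H¹` -/

section Primitive

variable {E : Type*} [NormedAddCommGroup E]

/-- Absolute continuity passes to functions with smaller increments. -/
lemma absolutelyContinuous_of_dist_le {X Y : Type*} [PseudoMetricSpace X] [PseudoMetricSpace Y]
    {F : ℝ → X} {G : ℝ → Y} {a b : ℝ} (hF : AbsolutelyContinuousOnInterval F a b)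
    (h : ∀ x ∈ uIcc a b, ∀ y ∈ uIcc a b, dist (G x) (G y) ≤ dist (F x) (F y)) :
    AbsolutelyContinuousOnInterval G a b := by
  rw [absolutelyContinuousOnInterval_iff] at hF ⊢
  intro ε hε
  obtain ⟨δ, hδ, H⟩ := hF ε hε
  refine ⟨δ, hδ, fun I hI hlt => lt_of_le_of_lt ?_ (H I hI hlt)⟩
  exact Finset.sum_le_sum fun i hi => h _ (hI.1 i hi).1 _ (hI.1 i hi).2

lemma intervalIntegrable_of_mem_Icc {v : ℝ → E} {a b s t : ℝ}
    (h : IntervalIntegrable v volume a b) (hs : s ∈ Icc a b) (ht : t ∈ Icc a b) :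
    IntervalIntegrable v volume s t := by
  refine h.mono_set ?_
  rw [uIcc_of_le (hs.1.trans hs.2)]
  exact ordConnected_Icc.uIcc_subset hs ht

variable [NormedSpace ℝ E]

/-- `u` is a primitive of `v` on `[a,b]`: the integrable function `v` recovers all increments
of `u`. -/
def IsPrimitiveOn (u v : ℝ → E) (a b : ℝ) : Prop :=
  IntervalIntegrable v volume a b ∧
    ∀ s ∈ Icc a b, ∀ t ∈ Icc a b, u t - u s = ∫ r in s..t, v r

lemma isPrimitiveOn_of_left {u v : ℝ → E} {a b : ℝ}
    (hv : IntervalIntegrable v volume a b)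
    (h : ∀ t ∈ Icc a b, u t = u a + ∫ r in a..t, v r) : IsPrimitiveOn u v a b := by
  refine ⟨hv, fun s hs t ht => ?_⟩
  have ha : a ∈ Icc a b := ⟨le_rfl, hs.1.trans hs.2⟩
  rw [h s hs, h t ht, add_sub_add_left_eq_sub]
  exact intervalIntegral.integral_interval_sub_left
    (intervalIntegrable_of_mem_Icc hv ha ht) (intervalIntegrable_of_mem_Icc hv ha hs)

lemma IsPrimitiveOn.left {u v : ℝ → E} {a b : ℝ} (h : IsPrimitiveOn u v a b)
    {t : ℝ} (ht : t ∈ Icc a b) : u t = u a + ∫ r in a..t, v r := by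
  rw [← h.2 a ⟨le_rfl, ht.1.trans ht.2⟩ t ht]; abel

lemma IsPrimitiveOn.mono {u v : ℝ → E} {a b c d : ℝ} (h : IsPrimitiveOn u v a b)
    (hc : c ∈ Icc a b) (hd : d ∈ Icc a b) : IsPrimitiveOn u v c d :=
  ⟨intervalIntegrable_of_mem_Icc h.1 hc hd, fun s hs t ht =>
    h.2 s ⟨hc.1.trans hs.1, hs.2.trans hd.2⟩ t ⟨hc.1.trans ht.1, ht.2.trans hd.2⟩⟩

lemma absolutelyContinuous_intervalIntegral {v : ℝ → E} {a b : ℝ} (hab : a ≤ b)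
    (hv : IntervalIntegrable v volume a b) :
    AbsolutelyContinuousOnInterval (fun x => ∫ r in a..x, v r) a b := by
  refine absolutelyContinuous_of_dist_le
    (hv.norm.absolutelyContinuousOnInterval_intervalIntegral (c := a) left_mem_uIcc) ?_
  intro x hx y hy
  rw [uIcc_of_le hab] at hx hy
  have ha : a ∈ Icc a b := ⟨le_rfl, hab⟩
  rw [dist_eq_norm, dist_eq_norm, intervalIntegral.integral_interval_sub_left
    (intervalIntegrable_of_mem_Icc hv ha hx) (intervalIntegrable_of_mem_Icc hv ha hy),
    intervalIntegral.integral_interval_sub_left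
    (intervalIntegrable_of_mem_Icc hv.norm ha hx) (intervalIntegrable_of_mem_Icc hv.norm ha hy),
    Real.norm_eq_abs]
  exact intervalIntegral.norm_integral_le_abs_integral_norm

lemma IsPrimitiveOn.absolutelyContinuous {u v : ℝ → E} {a b : ℝ} (h : IsPrimitiveOn u v a b)
    (hab : a ≤ b) : AbsolutelyContinuousOnInterval u a b := by
  refine absolutelyContinuous_of_dist_le (absolutelyContinuous_intervalIntegral hab h.1) ?_
  intro x hx y hy
  rw [uIcc_of_le hab] at hx hy
  rw [h.left hx, h.left hy, dist_add_left]

lemma IsPrimitiveOn.ae_hasDerivAt [CompleteSpace E] {u v : ℝ → E} {a b : ℝ}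
    (h : IsPrimitiveOn u v a b) : ∀ᵐ t, t ∈ Ioo a b → HasDerivAt u (v t) t := by
  filter_upwards [h.1.ae_hasDerivAt_integral] with t ht hmem
  have hab : a ≤ b := (hmem.1.trans hmem.2).le
  rw [uIcc_of_le hab] at ht
  have h1 := (ht (Ioo_subset_Icc_self hmem) a ⟨le_rfl, hab⟩).const_add (u a)
  refine h1.congr_of_eventuallyEq ?_
  filter_upwards [Ioo_mem_nhds hmem.1 hmem.2] with s hs
  exact h.left (Ioo_subset_Icc_self hs)

lemma IsPrimitiveOn.of_absolutelyContinuous [CompleteSpace E] {u : ℝ → E} {a b : ℝ} (hab : a ≤ b)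
    (hu : AbsolutelyContinuousOnInterval u a b)
    (hd : ∀ᵐ t ∂(volume.restrict (Ioo a b)), DifferentiableAt ℝ u t)
    (hi : IntervalIntegrable (deriv u) volume a b) : IsPrimitiveOn u (deriv u) a b := by
  refine isPrimitiveOn_of_left hi ?_
  have hac := hu.sub (absolutelyContinuous_intervalIntegral hab hi)
  obtain ⟨C, hC⟩ := hac.const_of_ae_hasDerivAt_zero (by
    rw [ae_restrict_iff' measurableSet_Ioo] at hd
    have hne : ∀ c : ℝ, ∀ᵐ t : ℝ, t ≠ c := fun c => by simp [ae_iff, measure_singleton]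
    filter_upwards [hd, hi.ae_hasDerivAt_integral, hne a, hne b] with t h1 h2 h3 h4 ht
    have ht' := ht
    rw [uIcc_of_le hab] at ht'
    have hIoo : t ∈ Ioo a b := ⟨lt_of_le_of_ne ht'.1 h3.symm, lt_of_le_of_ne ht'.2 h4⟩
    have := (h1 hIoo).hasDerivAt.sub (h2 ht a left_mem_uIcc)
    simpa using this)
  intro t ht
  rw [uIcc_of_le hab] at hC
  have h1 := hC t ht
  have h2 := hC a ⟨le_rfl, hab⟩
  simp only [Pi.sub_apply, intervalIntegral.integral_same, sub_zero] at h1 h2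
  rw [h2, ← h1]; abel

end Primitive

section InnerPrimitive

variable {E : Type*} [NormedAddCommGroup E] [InnerProductSpace ℝ E]

lemma absolutelyContinuous_inner {u w : ℝ → E} {a b : ℝ}
    (hu : AbsolutelyContinuousOnInterval u a b) (hw : AbsolutelyContinuousOnInterval w a b) :
    AbsolutelyContinuousOnInterval (fun t => inner ℝ (u t) (w t)) a b := by
  have key : ∀ y : ℝ → E, AbsolutelyContinuousOnInterval y a b →
      AbsolutelyContinuousOnInterval (fun t => ‖y t‖ * ‖y t‖) a b := fun y hy => by
    have : AbsolutelyContinuousOnInterval (fun t => ‖y t‖) a b :=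
      absolutelyContinuous_of_dist_le hy fun s _ t _ => by
        simpa only [dist_eq_norm] using dist_norm_norm_le (y s) (y t)
    exact this.fun_mul this
  -- polarization reduces the inner product to squares of norms
  have := ((key _ (hu.add hw)).sub (key _ (hu.sub hw))).const_mul (1 / 4)
  convert this using 2 with t
  simp only [Pi.add_apply, Pi.sub_apply, norm_add_mul_self_real, norm_sub_mul_self_real]
  ring

/-- The product rule, in integrated form, for the inner product of two primitives. -/
lemma IsPrimitiveOn.integral_inner [CompleteSpace E] {u v w ω : ℝ → E} {a b : ℝ} (hab : a ≤ b)
    (hu : IsPrimitiveOn u v a b) (hw : IsPrimitiveOn w ω a b) :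
    ∫ t in a..b, (inner ℝ (u t) (ω t) + inner ℝ (v t) (w t)) =
      inner ℝ (u b) (w b) - inner ℝ (u a) (w a) := by
  rw [← (absolutelyContinuous_inner (hu.absolutelyContinuous hab)
    (hw.absolutelyContinuous hab)).integral_deriv_eq_sub]
  refine intervalIntegral.integral_congr_ae ?_
  have hne : ∀ᵐ t : ℝ, t ≠ b := by simp [ae_iff, measure_singleton]
  filter_upwards [hu.ae_hasDerivAt, hw.ae_hasDerivAt, hne] with t h1 h2 h3 ht
  rw [uIoc_of_le hab] at ht
  have hIoo : t ∈ Ioo a b := ⟨ht.1, lt_of_le_of_ne ht.2 h3⟩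
  exact ((h1 hIoo).inner ℝ (h2 hIoo)).deriv.symm

end InnerPrimitive

section H1

variable {n : ℕ}

lemma IsH1.isPrimitiveOn {a b : ℝ} (hab : a ≤ b) {u : ℝ → EuclideanSpace ℝ (Fin n)}
    (h : IsH1 a b u) : IsPrimitiveOn u (deriv u) a b := by
  refine IsPrimitiveOn.of_absolutelyContinuous hab h.1 h.2.1 ?_
  rw [intervalIntegrable_iff_integrableOn_Ioo_of_le hab]
  exact h.2.2.integrable (by norm_num)

lemma IsPrimitiveOn.isH1 {a b : ℝ} (hab : a ≤ b) {u v : ℝ → EuclideanSpace ℝ (Fin n)}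
    (h : IsPrimitiveOn u v a b) (hv : MemLp v 2 (volume.restrict (Ioo a b))) :
    IsH1 a b u ∧ ∀ᵐ t ∂(volume.restrict (Ioo a b)), deriv u t = v t := by
  have h1 : ∀ᵐ t ∂(volume.restrict (Ioo a b)), HasDerivAt u (v t) t := by
    rw [ae_restrict_iff' measurableSet_Ioo]
    exact h.ae_hasDerivAt
  have h2 : ∀ᵐ t ∂(volume.restrict (Ioo a b)), deriv u t = v t := h1.mono fun t ht => ht.deriv
  refine ⟨⟨h.absolutelyContinuous hab, h1.mono fun t ht => ht.differentiableAt, ?_⟩, h2⟩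
  exact hv.ae_eq (h2.mono fun t ht => ht.symm)

end H1

/-! ### Primitives on the line and Grönwall inequalities -/

section GlobalPrimitive

variable {E : Type*} [NormedAddCommGroup E] [NormedSpace ℝ E]

/-- `u` is a primitive on the whole line of the integrable function `v`. Extending functions by
constants to the line makes all translations harmless. -/
structure IsGlobalPrimitive (u v : ℝ → E) : Prop where
  integrable : Integrable v
  incr : ∀ s t, u t - u s = ∫ r in s..t, v r

namespace IsGlobalPrimitive

variable {u v w ω : ℝ → E}

lemma isPrimitiveOn (h : IsGlobalPrimitive u v) (a b : ℝ) : IsPrimitiveOn u v a b :=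
  ⟨h.integrable.intervalIntegrable, fun s _ t _ => h.incr s t⟩

lemma continuous (h : IsGlobalPrimitive u v) : Continuous u := by
  have h1 : u = fun t => u 0 + ∫ r in (0 : ℝ)..t, v r := by
    funext t; rw [← h.incr]; abel
  rw [h1]
  exact continuous_const.add
    (intervalIntegral.continuous_primitive (fun a b => h.integrable.intervalIntegrable) 0)

lemma sub (h : IsGlobalPrimitive u v) (h' : IsGlobalPrimitive w ω) :
    IsGlobalPrimitive (fun t => u t - w t) (fun t => v t - ω t) := by
  refine ⟨h.integrable.sub h'.integrable, fun s t => ?_⟩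
  rw [intervalIntegral.integral_sub h.integrable.intervalIntegrable
    h'.integrable.intervalIntegrable, ← h.incr, ← h'.incr]
  abel

lemma reverse (h : IsGlobalPrimitive u v) (T : ℝ) :
    IsGlobalPrimitive (fun t => u (T - t)) (fun t => -v (T - t)) := by
  refine ⟨(h.integrable.comp_sub_left T).neg, fun s t => ?_⟩
  rw [intervalIntegral.integral_neg, intervalIntegral.integral_comp_sub_left, ← h.incr]
  abel

lemma norm_sub_le (h : IsGlobalPrimitive u v) {s t : ℝ} (hst : s ≤ t) :
    ‖u t - u s‖ ≤ ∫ r in s..t, ‖v r‖ := by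
  rw [h.incr]
  exact intervalIntegral.norm_integral_le_integral_norm hst

lemma exists_bound (h : IsGlobalPrimitive u v) : ∃ C, ∀ t, ‖u t‖ ≤ C := by
  refine ⟨‖u 0‖ + ∫ r, ‖v r‖, fun t => ?_⟩
  have h1 : ‖u t - u 0‖ ≤ ∫ r, ‖v r‖ := by
    rw [h.incr]
    refine intervalIntegral.norm_integral_le_integral_norm_uIoc.trans ?_
    exact setIntegral_le_integral h.integrable.norm (ae_of_all _ fun _ => norm_nonneg _)
  calc ‖u t‖ = ‖u 0 + (u t - u 0)‖ := by rw [add_sub_cancel]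
    _ ≤ _ := (norm_add_le _ _).trans (by gcongr)

/-- A function with integrable derivative moves by `O(|σ - τ|)` in `L¹` under translations. -/
lemma integral_translate_le (h : IsGlobalPrimitive u v) (σ τ : ℝ) {a b : ℝ} (hab : a ≤ b) :
    ∫ s in a..b, ‖u (s - σ) - u (s - τ)‖ ≤ |σ - τ| * ∫ r, ‖v r‖ := by
  wlog hst : τ ≤ σ generalizing σ τ
  · have := this τ σ (le_of_not_ge hst)
    rw [abs_sub_comm] at this
    simpa only [norm_sub_rev] using this
  set V : ℝ → ℝ := fun t => ∫ r in (0 : ℝ)..t, ‖v r‖ with hV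
  have hint : ∀ x y, IntervalIntegrable (fun r => ‖v r‖) volume x y :=
    fun x y => h.integrable.norm.intervalIntegrable
  have hVc : Continuous V := intervalIntegral.continuous_primitive hint 0
  have hVsub : ∀ x y, V y - V x = ∫ r in x..y, ‖v r‖ := fun x y =>
    intervalIntegral.integral_interval_sub_left (hint _ _) (hint _ _)
  have hVi : ∀ x y, IntervalIntegrable V volume x y := fun x y => hVc.intervalIntegrable x y
  have hu := h.continuous
  rw [abs_of_nonneg (sub_nonneg.2 hst)]
  calc ∫ s in a..b, ‖u (s - σ) - u (s - τ)‖
      ≤ ∫ s in a..b, (V (s - τ) - V (s - σ)) := by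
        refine intervalIntegral.integral_mono_on hab
          (Continuous.intervalIntegrable (by fun_prop) _ _)
          (Continuous.intervalIntegrable (by fun_prop) _ _) fun s _ => ?_
        rw [norm_sub_rev, hVsub]
        exact h.norm_sub_le (by linarith)
    _ = (∫ s in a - τ..b - τ, V s) - ∫ s in a - σ..b - σ, V s := by
        rw [intervalIntegral.integral_sub (Continuous.intervalIntegrable (by fun_prop) _ _)
          (Continuous.intervalIntegrable (by fun_prop) _ _),
          intervalIntegral.integral_comp_sub_right, intervalIntegral.integral_comp_sub_right]
    _ = (∫ s in b - σ..b - τ, V s) - ∫ s in a - σ..a - τ, V s := by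
        have h1 := intervalIntegral.integral_add_adjacent_intervals (hVi (a - σ) (a - τ))
          (hVi (a - τ) (b - τ))
        have h2 := intervalIntegral.integral_add_adjacent_intervals (hVi (a - σ) (b - σ))
          (hVi (b - σ) (b - τ))
        linarith
    _ = ∫ s in a - σ..a - τ, (V (s + (b - a)) - V s) := by
        rw [intervalIntegral.integral_sub (Continuous.intervalIntegrable (by fun_prop) _ _)
          (hVi _ _), intervalIntegral.integral_comp_add_right]
        congr 2 <;> ring
    _ ≤ ∫ _s in a - σ..a - τ, ∫ r, ‖v r‖ := by
        refine intervalIntegral.integral_mono_on (by linarith)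
          (Continuous.intervalIntegrable (by fun_prop) _ _) (by simp) fun s _ => ?_
        rw [hVsub, intervalIntegral.integral_of_le (by linarith)]
        exact setIntegral_le_integral h.integrable.norm (ae_of_all _ fun _ => norm_nonneg _)
    _ = (σ - τ) * ∫ r, ‖v r‖ := by
        rw [intervalIntegral.integral_const, smul_eq_mul]; ring

end IsGlobalPrimitive

/-- A primitive on `[a,b]` extends by constants to a primitive on the line. -/
lemma IsPrimitiveOn.exists_extension {u v : ℝ → E} {a b : ℝ} (hab : a ≤ b)
    (h : IsPrimitiveOn u v a b) :
    ∃ w, IsGlobalPrimitive w (indicator (Ioc a b) v) ∧ EqOn w u (Icc a b) ∧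
      (∀ t ≤ a, w t = u a) ∧ ∀ t, b ≤ t → w t = u b := by
  have hi : Integrable (indicator (Ioc a b) v) :=
    ((intervalIntegrable_iff_integrableOn_Ioc_of_le hab).1 h.1).integrable_indicator
      measurableSet_Ioc
  have hii : ∀ s t, IntervalIntegrable (indicator (Ioc a b) v) volume s t :=
    fun s t => hi.intervalIntegrable
  have hmid : ∀ t ∈ Icc a b, u a + ∫ r in a..t, indicator (Ioc a b) v r = u t := by
    intro t ht
    rw [h.left ht]
    congr 1
    refine intervalIntegral.integral_congr_ae (ae_of_all _ fun r hr => ?_)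
    rw [uIoc_of_le ht.1] at hr
    exact indicator_of_mem (show r ∈ Ioc a b from ⟨hr.1, hr.2.trans ht.2⟩) _
  have hzero : ∀ s t, s ≤ t → (t ≤ a ∨ b ≤ s) → ∫ r in s..t, indicator (Ioc a b) v r = 0 := by
    intro s t hst hor
    refine intervalIntegral.integral_zero_ae (ae_of_all _ fun r hr => ?_)
    rw [uIoc_of_le hst] at hr
    refine indicator_of_notMem (fun hr' => ?_) _
    rcases hor with h1 | h1
    · exact absurd hr'.1 (not_lt.2 (hr.2.trans h1))
    · exact absurd hr'.2 (not_le.2 (h1.trans_lt hr.1))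
  refine ⟨fun t => u a + ∫ r in a..t, indicator (Ioc a b) v r, ⟨hi, fun s t => ?_⟩, hmid,
    fun t ht => ?_, fun t ht => ?_⟩
  · rw [add_sub_add_left_eq_sub, intervalIntegral.integral_interval_sub_left (hii _ _) (hii _ _)]
  · simp only
    rw [intervalIntegral.integral_symm, hzero t a ht (Or.inl le_rfl)]
    simp
  · simp only
    rw [← intervalIntegral.integral_add_adjacent_intervals (hii a b) (hii b t),
      hzero b t ht (Or.inr le_rfl), add_zero, hmid b ⟨hab, le_rfl⟩]

end GlobalPrimitive

section Gronwall

lemma integral_gronwall {m : ℝ → ℝ} (hm : Continuous m) {C K T : ℝ} (hK : 0 ≤ K)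
    (h : ∀ t ∈ Icc 0 T, m t ≤ C + K * ∫ s in (0 : ℝ)..t, m s) :
    ∀ t ∈ Icc 0 T, m t ≤ C * Real.exp (K * t) := by
  have hd : ∀ t, HasDerivAt (fun t => C + K * ∫ s in (0 : ℝ)..t, m s) (K * m t) t := fun t =>
    ((intervalIntegral.integral_hasDerivAt_right (hm.intervalIntegrable _ _)
      hm.stronglyMeasurable.stronglyMeasurableAtFilter hm.continuousAt).const_mul K).const_add C
  intro t ht
  refine (h t ht).trans ?_
  have := le_gronwallBound_of_liminf_deriv_right_le (δ := C) (K := K) (ε := 0) (a := 0) (b := T)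
    (f := fun t => C + K * ∫ s in (0 : ℝ)..t, m s) (f' := fun t => K * m t)
    (fun t _ => (hd t).continuousAt.continuousWithinAt)
    (fun x _ r hr => (hd x).hasDerivWithinAt.liminf_right_slope_le hr) (by simp)
    (fun x hx => by
      have := mul_le_mul_of_nonneg_left (h x (Ico_subset_Icc_self hx)) hK
      simpa using this) t ht
  simpa [gronwallBound_ε0] using this

/-- Grönwall's inequality with delay: the history on `[-b,0]` only enlarges the constant. -/
lemma delay_gronwall {m : ℝ → ℝ} (hm : Continuous m) (hm0 : ∀ t, 0 ≤ m t) {C K T b τ M : ℝ}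
    (hK : 0 ≤ K) (hC : 0 ≤ C) (hτ : τ ∈ Icc 0 b) (hM : ∀ t ∈ Icc (-b) 0, m t ≤ M)
    (h : ∀ t ∈ Icc 0 T, m t ≤ C + K * ∫ s in (0 : ℝ)..t, (m s + m (s - τ))) :
    ∀ t ∈ Icc 0 T, m t ≤ (C + K * (b * M)) * Real.exp (2 * K * T) := by
  have hi : ∀ x y, IntervalIntegrable m volume x y := fun x y => hm.intervalIntegrable x y
  have hb : 0 ≤ b := hτ.1.trans hτ.2
  have hM0 : 0 ≤ M := (hm0 0).trans (hM 0 ⟨by linarith, le_rfl⟩)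
  have h1 : ∀ t ∈ Icc 0 T, m t ≤ C + K * (b * M) + 2 * K * ∫ s in (0 : ℝ)..t, m s := by
    intro t ht
    refine (h t ht).trans ?_
    have h2 : ∫ s in (0 : ℝ)..t, m (s - τ) ≤ b * M + ∫ s in (0 : ℝ)..t, m s := by
      rw [intervalIntegral.integral_comp_sub_right]
      have e1 := intervalIntegral.integral_add_adjacent_intervals (hi (0 - τ) (t - τ))
        (hi (t - τ) t)
      have e2 := intervalIntegral.integral_add_adjacent_intervals (hi (0 - τ) 0) (hi 0 t)
      have e3 : 0 ≤ ∫ s in t - τ..t, m s :=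
        intervalIntegral.integral_nonneg (by linarith [hτ.1]) fun s _ => hm0 s
      have e4 : ∫ s in (0 - τ)..0, m s ≤ τ * M := by
        have := intervalIntegral.integral_mono_on (a := 0 - τ) (b := 0) (by linarith [hτ.1])
          (hi _ _) (intervalIntegrable_const (c := M)) fun s hs =>
            hM s ⟨by linarith [hs.1, hτ.2], hs.2⟩
        simpa using this
      have e5 : τ * M ≤ b * M := by gcongr; exact hτ.2
      linarith
    rw [intervalIntegral.integral_add (hi _ _) (Continuous.intervalIntegrable (by fun_prop) _ _)]
    nlinarith [mul_le_mul_of_nonneg_left h2 hK]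
  intro t ht
  refine (integral_gronwall hm (by positivity) h1 t ht).trans ?_
  have : 0 ≤ C + K * (b * M) := by positivity
  gcongr
  exact ht.2

variable {E : Type*} [NormedAddCommGroup E] [NormedSpace ℝ E]

/-- Solutions of linear delay inequalities with zero history are controlled by the forcing. -/
lemma IsGlobalPrimitive.delay_gronwall {w ω : ℝ → E} (hw : IsGlobalPrimitive w ω) {K T τ : ℝ}
    {h : ℝ → ℝ} (hK : 0 ≤ K) (hτ : 0 ≤ τ) (hw0 : ∀ t ≤ 0, w t = 0)
    (hh : IntervalIntegrable h volume 0 T) (hh0 : ∀ t, 0 ≤ h t)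
    (hae : ∀ᵐ t ∂(volume.restrict (Ioo 0 T)), ‖ω t‖ ≤ K * (‖w t‖ + ‖w (t - τ)‖) + h t) :
    ∀ t ∈ Icc 0 T, ‖w t‖ ≤ (∫ s in (0 : ℝ)..T, h s) * Real.exp (2 * K * T) := by
  intro t ht
  have hT : 0 ≤ T := ht.1.trans ht.2
  have hc := hw.continuous
  have h0 : 0 ≤ ∫ s in (0 : ℝ)..T, h s := intervalIntegral.integral_nonneg hT fun s _ => hh0 s
  have key := DelayOpt.delay_gronwall (m := fun t => ‖w t‖) (by fun_prop)
    (fun t => norm_nonneg _) (C := ∫ s in (0 : ℝ)..T, h s) (K := K) (T := T) (b := τ) (τ := τ)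
    (M := 0) hK h0 ⟨hτ, le_rfl⟩ (fun t ht => by simp [hw0 t ht.2]) (fun t ht => ?_) t ht
  · simpa using key
  · have hht : IntervalIntegrable h volume 0 t :=
      intervalIntegrable_of_mem_Icc hh ⟨le_rfl, hT⟩ ht
    have hci : IntervalIntegrable (fun s => K * (‖w s‖ + ‖w (s - τ)‖)) volume 0 t :=
      Continuous.intervalIntegrable (by fun_prop) _ _
    calc ‖w t‖ = ‖w t - w 0‖ := by rw [hw0 0 le_rfl, sub_zero]
      _ ≤ ∫ s in (0 : ℝ)..t, ‖ω s‖ := hw.norm_sub_le ht.1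
      _ ≤ ∫ s in (0 : ℝ)..t, (K * (‖w s‖ + ‖w (s - τ)‖) + h s) := by
          refine intervalIntegral.integral_mono_ae_restrict ht.1
            hw.integrable.norm.intervalIntegrable (hci.add hht) ?_
          have h1 : (volume.restrict (Icc 0 t) : Measure ℝ) = volume.restrict (Ioo 0 t) :=
            Measure.restrict_congr_set Ioo_ae_eq_Icc.symm
          rw [h1]
          exact ae_restrict_of_ae_restrict_of_subset (Ioo_subset_Ioo_right ht.2) hae
      _ = K * (∫ s in (0 : ℝ)..t, (‖w s‖ + ‖w (s - τ)‖)) + ∫ s in (0 : ℝ)..t, h s := by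
          rw [intervalIntegral.integral_add hci hht, intervalIntegral.integral_const_mul]
      _ ≤ (∫ s in (0 : ℝ)..T, h s) + K * ∫ s in (0 : ℝ)..t, (‖w s‖ + ‖w (s - τ)‖) := by
          rw [add_comm]
          gcongr
          rw [← intervalIntegral.integral_add_adjacent_intervals hht
            (intervalIntegrable_of_mem_Icc hh ht ⟨hT, le_rfl⟩)]
          have := intervalIntegral.integral_nonneg (μ := volume) ht.2 fun s _ => hh0 s
          linarith

end Gronwall

/-! ### Existence for Lipschitz delay equations and the energy estimate -/

section Existence

variable {E : Type*} [NormedAddCommGroup E] [NormedSpace ℝ E] [CompleteSpace E]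

/-- Picard iteration for a delay equation in integrated form, with a globally Lipschitz right-hand
side `G`. The function `c` carries both the history and the forcing. -/
lemma exists_delay_solution {G : ℝ → E → E → E} {c : ℝ → E} {K b T τ : ℝ}
    (hG : Continuous fun q : ℝ × E × E => G q.1 q.2.1 q.2.2)
    (hL : ∀ s y z y' z', ‖G s y z - G s y' z'‖ ≤ K * (‖y - y'‖ + ‖z - z'‖))
    (hc : Continuous c) (hK : 0 ≤ K) (hb : 0 ≤ b) (hT : 0 ≤ T) (hτ : 0 ≤ τ) :
    ∃ u : ℝ → E, Continuous u ∧ (∀ t ∈ Icc (-b) 0, u t = c t) ∧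
      ∀ t ∈ Icc 0 T, u t = c t + ∫ s in (0 : ℝ)..t, G s (u s) (u (s - τ)) := by
  have hle : -b ≤ T := by linarith
  -- with the weight `exp (-κ t)` the Picard map is a contraction on the whole interval
  set κ : ℝ := 4 * K + 1 with hκ
  have hκ0 : 0 < κ := by positivity
  let U : C(Icc (-b) T, E) → ℝ → E := fun w s => Real.exp (κ * s) • IccExtend hle w s
  have hU : ∀ w, Continuous (U w) := fun w => by
    have : Continuous (IccExtend hle w) := w.continuous.Icc_extend'
    fun_prop
  have hUd : ∀ w w' s, ‖U w s - U w' s‖ ≤ Real.exp (κ * s) * dist w w' := fun w w' s => by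
    rw [← smul_sub, norm_smul, Real.norm_eq_abs, Real.abs_exp]
    gcongr
    rw [← dist_eq_norm]
    exact ContinuousMap.dist_apply_le_dist _
  have hI : ∀ w, Continuous fun s => G s (U w s) (U w (s - τ)) := fun w => by
    have h1 := hU w
    exact hG.comp (by fun_prop : Continuous fun s => (s, U w s, U w (s - τ)))
  have hIi : ∀ w x y, IntervalIntegrable (fun s => G s (U w s) (U w (s - τ))) volume x y :=
    fun w x y => (hI w).intervalIntegrable x y
  have hprim : ∀ w, Continuous fun t : ℝ => ∫ s in (0 : ℝ)..t, G s (U w s) (U w (s - τ)) :=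
    fun w => intervalIntegral.continuous_primitive (hIi w) 0
  let Φ : C(Icc (-b) T, E) → C(Icc (-b) T, E) := fun w =>
    ⟨fun t => Real.exp (-(κ * t)) •
      (c t + ∫ s in (0 : ℝ)..max (t : ℝ) 0, G s (U w s) (U w (s - τ))), by
      have h1 : Continuous fun t : Icc (-b) T =>
          ∫ s in (0 : ℝ)..max (t : ℝ) 0, G s (U w s) (U w (s - τ)) :=
        (hprim w).comp (by fun_prop : Continuous fun t : Icc (-b) T => max (t : ℝ) 0)
      fun_prop⟩
  have hΦ : ContractingWith (1 / 2) Φ := by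
    refine ⟨by norm_num, LipschitzWith.of_dist_le_mul fun w w' => ?_⟩
    have hd : 0 ≤ dist w w' := dist_nonneg
    have hcoe : (((1 / 2 : NNReal)) : ℝ) = 1 / 2 := by norm_num
    rw [hcoe, ContinuousMap.dist_le (by positivity)]
    intro t
    set r : ℝ := max (t : ℝ) 0 with hr
    have hr0 : 0 ≤ r := le_max_right _ _
    change dist (Real.exp (-(κ * t)) • (c t + ∫ s in (0 : ℝ)..r, G s (U w s) (U w (s - τ))))
      (Real.exp (-(κ * t)) • (c t + ∫ s in (0 : ℝ)..r, G s (U w' s) (U w' (s - τ)))) ≤ _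
    rw [dist_smul₀, dist_add_left, dist_eq_norm, Real.norm_eq_abs, Real.abs_exp,
      ← intervalIntegral.integral_sub (hIi _ _ _) (hIi _ _ _)]
    have hexp : ∫ s in (0 : ℝ)..r, Real.exp (κ * s) = (Real.exp (κ * r) - 1) / κ := by
      rw [intervalIntegral.integral_comp_mul_left (fun x => Real.exp x) hκ0.ne', integral_exp]
      simp [div_eq_inv_mul]
    have hbound : ‖∫ s in (0 : ℝ)..r, (G s (U w s) (U w (s - τ)) - G s (U w' s) (U w' (s - τ)))‖
        ≤ 2 * K * dist w w' * ((Real.exp (κ * r) - 1) / κ) := by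
      rw [← hexp, ← intervalIntegral.integral_const_mul]
      refine intervalIntegral.norm_integral_le_of_norm_le hr0 (ae_of_all _ fun s _ => ?_)
        (Continuous.intervalIntegrable (by fun_prop) _ _)
      have h1 := hUd w w' s
      have h2 := hUd w w' (s - τ)
      have h3 : Real.exp (κ * (s - τ)) ≤ Real.exp (κ * s) := by
        gcongr; linarith
      have h4 := mul_le_mul_of_nonneg_right h3 hd
      refine (hL _ _ _ _ _).trans ?_
      nlinarith [mul_le_mul_of_nonneg_left (add_le_add h1 (h2.trans h4)) hK]
    rcases le_total (t : ℝ) 0 with ht | ht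
    · have : r = 0 := max_eq_right ht
      rw [this, intervalIntegral.integral_same, norm_zero, mul_zero]
      positivity
    · have hrt : r = t := max_eq_left ht
      rw [hrt] at hbound ⊢
      refine (mul_le_mul_of_nonneg_left hbound (Real.exp_pos _).le).trans ?_
      have h5 : Real.exp (-(κ * t)) * Real.exp (κ * t) = 1 := by
        rw [← Real.exp_add]; simp
      have h6 : Real.exp (-(κ * t)) * (2 * K * dist w w' * ((Real.exp (κ * t) - 1) / κ))
          = 2 * K / κ * dist w w' * (1 - Real.exp (-(κ * t))) := by
        linear_combination (2 * K * dist w w' / κ) * h5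
      have h7 : 2 * K / κ ≤ 1 / 2 := by
        rw [div_le_iff₀ hκ0]; linarith
      rw [h6]
      calc 2 * K / κ * dist w w' * (1 - Real.exp (-(κ * t)))
          ≤ 2 * K / κ * dist w w' * 1 := by
            gcongr
            linarith [Real.exp_pos (-(κ * t))]
        _ ≤ 1 / 2 * dist w w' := by rw [mul_one]; gcongr
  obtain ⟨w, hw⟩ : ∃ w, Φ w = w := ⟨_, hΦ.fixedPoint_isFixedPt⟩
  have hsol : ∀ t ∈ Icc (-b) T,
      U w t = c t + ∫ s in (0 : ℝ)..max t 0, G s (U w s) (U w (s - τ)) := by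
    intro t ht
    have h1 : IccExtend hle w t = Real.exp (-(κ * t)) •
        (c t + ∫ s in (0 : ℝ)..max t 0, G s (U w s) (U w (s - τ))) := by
      rw [IccExtend_of_mem hle w ht]
      exact (DFunLike.congr_fun hw ⟨t, ht⟩).symm
    change Real.exp (κ * t) • IccExtend hle w t = _
    rw [h1, smul_smul, ← Real.exp_add]
    simp
  refine ⟨U w, hU w, fun t ht => ?_, fun t ht => ?_⟩
  · rw [hsol t ⟨ht.1, ht.2.trans hT⟩, max_eq_right ht.2]; simp
  · rw [hsol t ⟨by linarith [ht.1], ht.2⟩, max_eq_left ht.1]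

end Existence

section Apriori

variable {E : Type*} [NormedAddCommGroup E] [InnerProductSpace ℝ E]

lemma intervalIntegrable_inner {u v : ℝ → E} {a b : ℝ} (hu : Continuous u)
    (hv : IntervalIntegrable v volume a b) :
    IntervalIntegrable (fun t => inner ℝ (u t) (v t)) volume a b := by
  have h1 : IntervalIntegrable (fun t => ‖u t‖ * ‖v t‖) volume a b :=
    hv.norm.continuousOn_mul (by fun_prop)
  refine h1.mono_fun ?_ (ae_of_all _ fun t => ?_)
  · exact hu.aestronglyMeasurable.inner hv.aestronglyMeasurable_restrict_uIoc
  · simp only [norm_mul, norm_norm]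
    exact norm_inner_le_norm _ _

variable [CompleteSpace E]

/-- The energy estimate. Since it uses only a one-sided bound on `F`, it is insensitive to cutting
off `F` far out, and it is uniform in the delay. -/
lemma norm_sq_le_of_delay_equation {x v g : ℝ → E} {F : E → E} {B : E →L[ℝ] E}
    {b T τ l c M : ℝ} (hT : 0 ≤ T) (hl : 0 ≤ l) (hτ : τ ∈ Icc 0 b)
    (hx : Continuous x) (hxv : IsPrimitiveOn x v 0 T)
    (hF : ∀ y, -(l * ‖y‖ ^ 2) - c * ‖y‖ ≤ inner ℝ (F y) y)
    (hM : ∀ t ∈ Icc (-b) 0, ‖x t‖ ≤ M)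
    (hg : IntervalIntegrable (fun t => ‖g t‖ ^ 2) volume 0 T)
    (heq : ∀ᵐ t ∂(volume.restrict (Ioo 0 T)), v t + F (x t) = B (x (t - τ)) + g t) :
    ∀ t ∈ Icc 0 T, ‖x t‖ ^ 2 ≤ (M ^ 2 + (c ^ 2 * T + ∫ s in (0 : ℝ)..T, ‖g s‖ ^ 2) +
      (2 * l + 2 + ‖B‖) * (b * M ^ 2)) * Real.exp (2 * (2 * l + 2 + ‖B‖) * T) := by
  have hb : 0 ≤ b := hτ.1.trans hτ.2
  have hM2 : ∀ t ∈ Icc (-b) 0, ‖x t‖ ^ 2 ≤ M ^ 2 := fun t ht =>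
    pow_le_pow_left₀ (norm_nonneg _) (hM t ht) 2
  have hg0 : 0 ≤ ∫ s in (0 : ℝ)..T, ‖g s‖ ^ 2 :=
    intervalIntegral.integral_nonneg hT fun s _ => by positivity
  refine delay_gronwall (m := fun t => ‖x t‖ ^ 2) (by fun_prop) (fun t => by positivity)
    (by positivity) (by positivity) hτ hM2 fun t ht => ?_
  -- the weights of `‖x s‖ ^ 2` and `‖x (s - τ)‖ ^ 2` left by Young's inequality are at most `K`
  set K : ℝ := 2 * l + 2 + ‖B‖ with hKdef
  have hp : IsPrimitiveOn x v 0 t := hxv.mono ⟨le_rfl, hT⟩ ht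
  have hgt : IntervalIntegrable (fun t => ‖g t‖ ^ 2) volume 0 t :=
    intervalIntegrable_of_mem_Icc hg ⟨le_rfl, hT⟩ ht
  have hci : IntervalIntegrable (fun s => K * (‖x s‖ ^ 2 + ‖x (s - τ)‖ ^ 2)) volume 0 t :=
    Continuous.intervalIntegrable (by fun_prop) _ _
  have hgc : IntervalIntegrable (fun s => c ^ 2 + ‖g s‖ ^ 2) volume 0 t :=
    intervalIntegrable_const.add hgt
  have hi1 := intervalIntegrable_inner hx hp.1
  have hi2 : IntervalIntegrable (fun s => inner ℝ (v s) (x s)) volume 0 t := by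
    simpa only [real_inner_comm] using hi1
  have hprod := hp.integral_inner ht.1 hp
  rw [real_inner_self_eq_norm_sq, real_inner_self_eq_norm_sq] at hprod
  have hle : ∫ s in (0 : ℝ)..t, (inner ℝ (x s) (v s) + inner ℝ (v s) (x s)) ≤
      ∫ s in (0 : ℝ)..t, (K * (‖x s‖ ^ 2 + ‖x (s - τ)‖ ^ 2) + (c ^ 2 + ‖g s‖ ^ 2)) := by
    refine intervalIntegral.integral_mono_ae_restrict ht.1 (hi1.add hi2) (hci.add hgc) ?_
    have h1 : (volume.restrict (Icc 0 t) : Measure ℝ) = volume.restrict (Ioo 0 t) :=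
      Measure.restrict_congr_set Ioo_ae_eq_Icc.symm
    rw [h1]
    filter_upwards [ae_restrict_of_ae_restrict_of_subset (Ioo_subset_Ioo_right ht.2) heq] with s hs
    have hv : v s = B (x (s - τ)) + g s - F (x s) := eq_sub_of_add_eq hs
    have e1 : inner ℝ (v s) (x s) = inner ℝ (B (x (s - τ))) (x s) + inner ℝ (g s) (x s)
        - inner ℝ (F (x s)) (x s) := by rw [hv, inner_sub_left, inner_add_left]
    have e2 : inner ℝ (B (x (s - τ))) (x s) ≤ ‖B‖ * ‖x (s - τ)‖ * ‖x s‖ :=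
      (real_inner_le_norm _ _).trans (by gcongr; exact B.le_opNorm _)
    have e3 : inner ℝ (g s) (x s) ≤ ‖g s‖ * ‖x s‖ := real_inner_le_norm _ _
    have e4 := hF (x s)
    have e5 : ‖B‖ * (2 * ‖x (s - τ)‖ * ‖x s‖) ≤ ‖B‖ * (‖x (s - τ)‖ ^ 2 + ‖x s‖ ^ 2) := by
      gcongr; exact two_mul_le_add_sq _ _
    have e6 := two_mul_le_add_sq c ‖x s‖
    have e7 := two_mul_le_add_sq ‖g s‖ ‖x s‖
    have e8 : 0 ≤ (2 * l + 2) * ‖x (s - τ)‖ ^ 2 := by positivity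
    rw [real_inner_comm (v s) (x s), e1]
    rw [hKdef]
    linarith
  rw [intervalIntegral.integral_add hci hgc, intervalIntegral.integral_const_mul,
    intervalIntegral.integral_add intervalIntegrable_const hgt, hprod] at hle
  have hgT : ∫ s in (0 : ℝ)..t, ‖g s‖ ^ 2 ≤ ∫ s in (0 : ℝ)..T, ‖g s‖ ^ 2 := by
    rw [← intervalIntegral.integral_add_adjacent_intervals hgt
      (intervalIntegrable_of_mem_Icc hg ht ⟨hT, le_rfl⟩)]
    have := intervalIntegral.integral_nonneg (μ := volume) ht.2
      fun s _ => (by positivity : 0 ≤ ‖g s‖ ^ 2)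
    linarith
  have hct : ∫ _s in (0 : ℝ)..t, c ^ 2 ≤ c ^ 2 * T := by
    rw [intervalIntegral.integral_const, smul_eq_mul, sub_zero, mul_comm]
    gcongr
    exact ht.2
  have h0 := hM2 0 ⟨by linarith, le_rfl⟩
  linarith

end Apriori

/-! ### The pairing of a function with a delayed function -/

section Pairing

open scoped Topology

variable {E : Type*} [NormedAddCommGroup E] [InnerProductSpace ℝ E]

lemma IsGlobalPrimitive.clm [CompleteSpace E] {u v : ℝ → E} (h : IsGlobalPrimitive u v)
    (B : E →L[ℝ] E) : IsGlobalPrimitive (fun t => B (u t)) (fun t => B (v t)) := by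
  refine ⟨B.integrable_comp h.integrable, fun s t => ?_⟩
  rw [← map_sub, h.incr, B.intervalIntegral_comp_comm h.integrable.intervalIntegrable]

lemma integral_inner_eq_integral_indicator {p v : ℝ → E} {T : ℝ} (hT : 0 ≤ T) :
    ∫ t in (0 : ℝ)..T, inner ℝ (p t) (v t) =
      ∫ t, inner ℝ (indicator (Ioc 0 T) p t) (v t) := by
  rw [intervalIntegral.integral_of_le hT, ← integral_indicator measurableSet_Ioc]
  congr 1
  funext t
  by_cases ht : t ∈ Ioc 0 T
  · rw [indicator_of_mem ht, indicator_of_mem ht]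
  · rw [indicator_of_notMem ht, indicator_of_notMem ht, inner_zero_left]

/-- After the substitution `s = t - r` the translation falls on the bounded factor `p`, which
is continuous off the two end points; so dominated convergence applies. -/
lemma continuous_integral_inner_translate {p v : ℝ → E} {T : ℝ} (hT : 0 ≤ T)
    (hp : Continuous p) (hv : Integrable v) :
    Continuous fun r => ∫ t in (0 : ℝ)..T, inner ℝ (p t) (v (t - r)) := by
  obtain ⟨C, hC⟩ := isCompact_Icc.exists_bound_of_continuousOn (s := Icc 0 T) hp.continuousOn
  have hC0 : 0 ≤ C := (norm_nonneg _).trans (hC 0 ⟨le_rfl, hT⟩)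
  have hb : ∀ t, ‖indicator (Ioc 0 T) p t‖ ≤ C := fun t => by
    by_cases ht : t ∈ Ioc 0 T
    · rw [indicator_of_mem ht]; exact hC t (Ioc_subset_Icc_self ht)
    · rw [indicator_of_notMem ht, norm_zero]; exact hC0
  have heq : (fun r => ∫ t in (0 : ℝ)..T, inner ℝ (p t) (v (t - r))) =
      fun r => ∫ s, inner ℝ (indicator (Ioc 0 T) p (s + r)) (v s) := by
    funext r
    rw [integral_inner_eq_integral_indicator (v := fun t => v (t - r)) hT,
      ← integral_sub_right_eq_self (fun s => inner ℝ (indicator (Ioc 0 T) p (s + r)) (v s)) r]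
    simp only [sub_add_cancel]
  have hpm : StronglyMeasurable (indicator (Ioc 0 T) p) :=
    hp.stronglyMeasurable.indicator measurableSet_Ioc
  rw [heq, continuous_iff_continuousAt]
  intro r₀
  refine continuousAt_of_dominated (bound := fun s => C * ‖v s‖)
    (.of_forall fun r => ?_) (.of_forall fun r => ae_of_all _ fun s => ?_)
    (hv.norm.const_mul C) ?_
  · exact (hpm.comp_measurable (measurable_id.add_const r)).aestronglyMeasurable.inner
      hv.aestronglyMeasurable
  · exact (norm_inner_le_norm _ _).trans (by gcongr; exact hb _)
  · have hne : ∀ c : ℝ, ∀ᵐ t : ℝ, t ≠ c := fun c => by simp [ae_iff, measure_singleton]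
    filter_upwards [hne (-r₀), hne (T - r₀)] with s h1 h2
    have h1' : s + r₀ ≠ 0 := fun h => h1 (by linarith)
    have h2' : s + r₀ ≠ T := fun h => h2 (by linarith)
    have hat : ContinuousAt (indicator (Ioc 0 T) p) (s + r₀) := by
      rcases lt_or_gt_of_ne h1' with h | h
      · refine (continuousAt_const (y := (0 : E))).congr ?_
        filter_upwards [Iio_mem_nhds h] with t ht
        exact (indicator_of_notMem (fun h' => lt_asymm ht h'.1) _).symm
      · rcases lt_or_gt_of_ne h2' with h' | h'
        · refine hp.continuousAt.congr ?_
          filter_upwards [Ioo_mem_nhds h h'] with t ht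
          exact (indicator_of_mem (Ioo_subset_Ioc_self ht) _).symm
        · refine (continuousAt_const (y := (0 : E))).congr ?_
          filter_upwards [Ioi_mem_nhds h'] with t ht
          exact (indicator_of_notMem (fun h'' => not_lt.2 h''.2 ht) _).symm
    have hadd : ContinuousAt (fun r => s + r) r₀ := by fun_prop
    exact (ContinuousAt.comp (f := fun r => s + r) hat hadd).inner continuousAt_const

lemma integral_integral_inner_translate [CompleteSpace E] {p u v : ℝ → E} {T : ℝ} (hT : 0 ≤ T)
    (hp : Continuous p) (h : IsGlobalPrimitive u v) (a b : ℝ) :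
    ∫ r in a..b, ∫ t in (0 : ℝ)..T, inner ℝ (p t) (v (t - r)) =
      ∫ t in (0 : ℝ)..T, inner ℝ (p t) (u (t - a) - u (t - b)) := by
  have hpi : Integrable (indicator (Ioc 0 T) p) :=
    ((intervalIntegrable_iff_integrableOn_Ioc_of_le hT).1
      (hp.intervalIntegrable 0 T)).integrable_indicator measurableSet_Ioc
  have hconv := hpi.convolution_integrand (innerSL ℝ) h.integrable.comp_neg
  have h1 : ∀ r, ∫ t in (0 : ℝ)..T, inner ℝ (p t) (v (t - r)) =
      ∫ t, inner ℝ (indicator (Ioc 0 T) p t) (v (t - r)) := fun r =>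
    integral_inner_eq_integral_indicator (v := fun t => v (t - r)) hT
  simp only [h1]
  rw [integral_inner_eq_integral_indicator (v := fun t => u (t - a) - u (t - b)) hT,
    intervalIntegral_integral_swap]
  · congr 1
    funext t
    have h2 : u (t - a) - u (t - b) = ∫ r in a..b, v (t - r) := by
      rw [intervalIntegral.integral_comp_sub_left, h.incr]
    rw [h2]
    exact (innerSL ℝ (indicator (Ioc 0 T) p t)).intervalIntegral_comp_comm
      (h.integrable.comp_sub_left t).intervalIntegrable
  · refine (hconv.mono_measure ?_).congr (ae_of_all _ fun q => ?_)
    · exact Measure.prod_mono Measure.restrict_le_self le_rfl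
    · simp only [Function.uncurry, neg_sub]
      rfl

/-- Differentiating the pairing of `p` with the delayed function, in the delay. Only the
primitive of `v` occurs in the pairing, so no regularity of `v` beyond integrability is needed. -/
lemma hasDerivAt_integral_inner_translate [CompleteSpace E] {p u v : ℝ → E} {T : ℝ} (hT : 0 ≤ T)
    (hp : Continuous p) (h : IsGlobalPrimitive u v) (r : ℝ) :
    HasDerivAt (fun r => ∫ t in (0 : ℝ)..T, inner ℝ (p t) (u (t - r)))
      (-∫ t in (0 : ℝ)..T, inner ℝ (p t) (v (t - r))) r := by
  have hc := continuous_integral_inner_translate hT hp h.integrable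
  have hu := h.continuous
  have hd := ((intervalIntegral.integral_hasDerivAt_right (hc.intervalIntegrable 0 r)
    hc.stronglyMeasurable.stronglyMeasurableAtFilter hc.continuousAt).const_sub
    (∫ t in (0 : ℝ)..T, inner ℝ (p t) (u (t - 0))))
  refine hd.congr_of_eventuallyEq (.of_forall fun s => ?_)
  simp only
  rw [integral_integral_inner_translate hT hp h, ← intervalIntegral.integral_sub
    (Continuous.intervalIntegrable (by fun_prop) _ _)
    (Continuous.intervalIntegrable (by fun_prop) _ _)]
  simp only [← inner_sub_right, sub_sub_cancel]

/-- Moving a delay from one factor to an advance on the other; nothing is lost at the ends since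
`p` vanishes after `T` and `z` vanishes before `0`. -/
lemma integral_inner_shift {p z : ℝ → E} (B : E →L[ℝ] E) {T τ : ℝ} (hτ : 0 ≤ τ)
    (hp : Continuous p) (hz : Continuous z) (hp0 : ∀ t, T ≤ t → p t = 0)
    (hz0 : ∀ t ≤ 0, z t = 0) :
    ∫ t in (0 : ℝ)..T, inner ℝ (p (t + τ)) (B (z t)) =
      ∫ t in (0 : ℝ)..T, inner ℝ (p t) (B (z (t - τ))) := by
  have hi : ∀ x y, IntervalIntegrable (fun t => inner ℝ (p t) (B (z (t - τ)))) volume x y :=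
    fun x y => Continuous.intervalIntegrable (by fun_prop) _ _
  have h1 : ∫ t in (0 : ℝ)..T, inner ℝ (p (t + τ)) (B (z t)) =
      ∫ t in 0 + τ..T + τ, inner ℝ (p t) (B (z (t - τ))) := by
    rw [← intervalIntegral.integral_comp_add_right]
    simp only [add_sub_cancel_right]
  have h2 : ∫ t in (0 : ℝ)..0 + τ, inner ℝ (p t) (B (z (t - τ))) = 0 := by
    refine intervalIntegral.integral_zero_ae (ae_of_all _ fun t ht => ?_)
    rw [uIoc_of_le (by linarith)] at ht
    rw [hz0 _ (by linarith [ht.2]), map_zero, inner_zero_right]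
  have h3 : ∫ t in T..T + τ, inner ℝ (p t) (B (z (t - τ))) = 0 := by
    refine intervalIntegral.integral_zero_ae (ae_of_all _ fun t ht => ?_)
    rw [uIoc_of_le (by linarith)] at ht
    rw [hp0 _ ht.1.le, inner_zero_left]
  have h4 := intervalIntegral.integral_add_adjacent_intervals (hi 0 (0 + τ)) (hi (0 + τ) (T + τ))
  have h5 := intervalIntegral.integral_add_adjacent_intervals (hi 0 T) (hi T (T + τ))
  linarith

end Pairing

/-! ### States and adjoint states on the line: stability and duality -/

section Stability

variable {E : Type*} [NormedAddCommGroup E] [InnerProductSpace ℝ E]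

/-- A state extended to the whole line: `x` is a primitive of `v`, which outside `[0,T]` is a
prescribed function `ψ`, independent of the delay. -/
structure IsLineState (T : ℝ) (B : E →L[ℝ] E) (f : E → E) (g φ ψ : ℝ → E) (τ : ℝ)
    (x v : ℝ → E) : Prop where
  prim : IsGlobalPrimitive x v
  initial : ∀ t ≤ 0, x t = φ t
  velocity : ∀ t, t < 0 ∨ T < t → v t = ψ t
  equation : ∀ᵐ t ∂(volume.restrict (Ioo 0 T)), v t + f (x t) = B (x (t - τ)) + g t

/-- An adjoint state extended to the whole line, with derivative `q`. -/
structure IsLineAdjoint [CompleteSpace E] (T : ℝ) (B : E →L[ℝ] E) (f : E → E) (xd : ℝ → E) (τ : ℝ)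
    (x p q : ℝ → E) : Prop where
  prim : IsGlobalPrimitive p q
  terminal : ∀ t, T ≤ t → p t = 0
  equation : ∀ᵐ t ∂(volume.restrict (Ioo 0 T)),
    -q t + ContinuousLinearMap.adjoint (fderiv ℝ f (x t)) (p t) =
      ContinuousLinearMap.adjoint B (p (t + τ)) + x t - xd t

variable {T L σ τ : ℝ} {B : E →L[ℝ] E} {f : E → E} {g φ ψ x v y w : ℝ → E}

/-- The difference of the equations for two delays, with the translation isolated. -/
lemma IsLineState.ae_norm_velocity_sub_le (hx : IsLineState T B f g φ ψ τ x v)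
    (hy : IsLineState T B f g φ ψ σ y w)
    (hL : ∀ t ∈ Icc 0 T, ‖f (y t) - f (x t)‖ ≤ L * ‖y t - x t‖) :
    ∀ᵐ t ∂(volume.restrict (Ioo 0 T)), ‖w t - v t‖ ≤ L * ‖y t - x t‖ +
      ‖B‖ * ‖y (t - σ) - x (t - σ)‖ + ‖B‖ * ‖x (t - σ) - x (t - τ)‖ := by
  filter_upwards [hx.equation, hy.equation, self_mem_ae_restrict measurableSet_Ioo]
    with t h1 h2 ht
  have h3 : w t - v t = -(f (y t) - f (x t)) + B (y (t - σ) - x (t - σ)) +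
      B (x (t - σ) - x (t - τ)) := by
    rw [eq_sub_of_add_eq h1, eq_sub_of_add_eq h2, map_sub, map_sub]
    abel
  rw [h3]
  refine (norm_add₃_le).trans ?_
  rw [norm_neg]
  gcongr
  · exact hL t (Ioo_subset_Icc_self ht)
  · exact B.le_opNorm _
  · exact B.le_opNorm _

lemma IsLineState.norm_sub_le (hx : IsLineState T B f g φ ψ τ x v)
    (hy : IsLineState T B f g φ ψ σ y w) (hT : 0 ≤ T) (hσ : 0 ≤ σ) (hL0 : 0 ≤ L)
    (hL : ∀ t ∈ Icc 0 T, ‖f (y t) - f (x t)‖ ≤ L * ‖y t - x t‖) :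
    ∀ t ≤ T, ‖y t - x t‖ ≤
      ‖B‖ * (|σ - τ| * ∫ r, ‖v r‖) * Real.exp (2 * (L + ‖B‖) * T) := by
  have hD : 0 ≤ ∫ r, ‖v r‖ := integral_nonneg fun _ => norm_nonneg _
  have hzero : ∀ t ≤ 0, y t - x t = 0 := fun t ht => by
    rw [hx.initial t ht, hy.initial t ht, sub_self]
  have hxc := hx.prim.continuous
  intro t ht
  rcases le_total t 0 with h0 | h0
  · rw [hzero t h0, norm_zero]; positivity
  refine ((hy.prim.sub hx.prim).delay_gronwall (K := L + ‖B‖) (T := T) (τ := σ)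
    (h := fun t => ‖B‖ * ‖x (t - σ) - x (t - τ)‖) (by positivity) hσ hzero
    (Continuous.intervalIntegrable (by fun_prop) _ _) (fun t => by positivity) ?_ t ⟨h0, ht⟩).trans
    ?_
  · filter_upwards [hx.ae_norm_velocity_sub_le hy hL] with s hs
    refine hs.trans ?_
    have e1 : 0 ≤ ‖B‖ * ‖y s - x s‖ := by positivity
    have e2 : 0 ≤ L * ‖y (s - σ) - x (s - σ)‖ := by positivity
    linarith
  · rw [intervalIntegral.integral_const_mul]
    gcongr
    exact hx.prim.integral_translate_le σ τ hT

lemma IsLineState.integral_norm_velocity_sub_le (hx : IsLineState T B f g φ ψ τ x v)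
    (hy : IsLineState T B f g φ ψ σ y w) (hT : 0 ≤ T) (hσ : 0 ≤ σ) (hL0 : 0 ≤ L)
    (hL : ∀ t ∈ Icc 0 T, ‖f (y t) - f (x t)‖ ≤ L * ‖y t - x t‖) {ζ : ℝ}
    (hζ : ∀ t ≤ T, ‖y t - x t‖ ≤ ζ) :
    ∫ t, ‖w t - v t‖ ≤ T * ((L + ‖B‖) * ζ) + ‖B‖ * (|σ - τ| * ∫ r, ‖v r‖) := by
  have hxc := hx.prim.continuous
  have h1 : ∫ t, ‖w t - v t‖ = ∫ t in (0 : ℝ)..T, ‖w t - v t‖ := by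
    rw [intervalIntegral.integral_of_le hT, ← integral_Icc_eq_integral_Ioc]
    refine (setIntegral_eq_integral_of_forall_compl_eq_zero fun t ht => ?_).symm
    have ht' : t < 0 ∨ T < t := by
      by_contra! h
      exact ht ⟨h.1, h.2⟩
    rw [hx.velocity t ht', hy.velocity t ht', sub_self, norm_zero]
  have hi : IntervalIntegrable (fun t => ‖B‖ * ‖x (t - σ) - x (t - τ)‖) volume 0 T :=
    Continuous.intervalIntegrable (by fun_prop) _ _
  rw [h1]
  calc ∫ t in (0 : ℝ)..T, ‖w t - v t‖
      ≤ ∫ t in (0 : ℝ)..T, ((L + ‖B‖) * ζ + ‖B‖ * ‖x (t - σ) - x (t - τ)‖) := by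
        refine intervalIntegral.integral_mono_ae_restrict hT
          (hy.prim.sub hx.prim).integrable.norm.intervalIntegrable
          (intervalIntegrable_const.add hi) ?_
        have h2 : (volume.restrict (Icc 0 T) : Measure ℝ) = volume.restrict (Ioo 0 T) :=
          Measure.restrict_congr_set Ioo_ae_eq_Icc.symm
        rw [h2]
        filter_upwards [hx.ae_norm_velocity_sub_le hy hL, self_mem_ae_restrict measurableSet_Ioo]
          with t h3 ht
        refine h3.trans ?_
        have e1 := mul_le_mul_of_nonneg_left (hζ t ht.2.le) hL0
        have e2 := mul_le_mul_of_nonneg_left (hζ (t - σ) (by linarith [ht.2])) (norm_nonneg B)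
        linarith
    _ ≤ _ := by
        rw [intervalIntegral.integral_add intervalIntegrable_const hi,
          intervalIntegral.integral_const, intervalIntegral.integral_const_mul, smul_eq_mul,
          sub_zero]
        gcongr
        exact hx.prim.integral_translate_le σ τ hT

variable [CompleteSpace E] {xd p q p' q' : ℝ → E}

/-- Stability of the adjoint state; reversing time turns the advance into a delay. -/
lemma IsLineAdjoint.norm_sub_le (hp : IsLineAdjoint T B f xd τ x p q)
    (hp' : IsLineAdjoint T B f xd σ y p' q') (hT : 0 ≤ T) (hσ : 0 ≤ σ) (hL0 : 0 ≤ L)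
    {ε ζ P : ℝ} (hP : ∀ t, ‖p t‖ ≤ P) (hε0 : 0 ≤ ε) (hζ0 : 0 ≤ ζ)
    (hL : ∀ t ∈ Icc 0 T, ‖fderiv ℝ f (y t)‖ ≤ L)
    (hε : ∀ t ∈ Icc 0 T, ‖fderiv ℝ f (y t) - fderiv ℝ f (x t)‖ ≤ ε)
    (hζ : ∀ t ∈ Icc 0 T, ‖y t - x t‖ ≤ ζ) :
    ∀ t ∈ Icc 0 T, ‖p' t - p t‖ ≤ (T * (ε * P + ζ) + ‖B‖ * (|σ - τ| * ∫ r, ‖q r‖)) *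
      Real.exp (2 * (L + ‖B‖) * T) := by
  have hP0 : 0 ≤ P := (norm_nonneg _).trans (hP 0)
  have hpc := hp.prim.continuous
  have hrp := hp.prim.reverse T
  have hgr := ((hp'.prim.reverse T).sub hrp).delay_gronwall (K := L + ‖B‖) (T := T) (τ := σ)
    (h := fun t => (ε * P + ζ) + ‖B‖ * ‖p (T - (t - σ)) - p (T - (t - τ))‖) (by positivity) hσ
    (fun t ht => by
      rw [hp.terminal _ (by linarith), hp'.terminal _ (by linarith), sub_self])
    (Continuous.intervalIntegrable (by fun_prop) _ _) (fun t => by positivity) ?_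
  · intro t ht
    have h1 := hgr (T - t) ⟨by linarith [ht.2], by linarith [ht.1]⟩
    simp only [sub_sub_cancel] at h1
    refine h1.trans ?_
    gcongr
    rw [intervalIntegral.integral_add (by simp)
      (Continuous.intervalIntegrable (by fun_prop) _ _), intervalIntegral.integral_const,
      intervalIntegral.integral_const_mul, smul_eq_mul, sub_zero]
    have h2 := hrp.integral_translate_le σ τ hT
    have h3 : ∫ r, ‖-q (T - r)‖ = ∫ r, ‖q r‖ := by
      simp only [norm_neg]
      exact integral_sub_left_eq_self (fun r => ‖q r‖) volume T
    rw [h3] at h2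
    gcongr
  · have hae : ∀ᵐ t ∂(volume.restrict (Ioo 0 T)), ‖q' t - q t‖ ≤ L * ‖p' t - p t‖ +
        ‖B‖ * ‖p' (t + σ) - p (t + σ)‖ + ((ε * P + ζ) + ‖B‖ * ‖p (t + σ) - p (t + τ)‖) := by
      filter_upwards [hp.equation, hp'.equation, self_mem_ae_restrict measurableSet_Ioo]
        with t h1 h2 ht
      have ht' := Ioo_subset_Icc_self ht
      set S := ContinuousLinearMap.adjoint (fderiv ℝ f (y t)) with hS
      set R := ContinuousLinearMap.adjoint (fderiv ℝ f (x t)) with hR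
      have h3 : q' t - q t = S (p' t - p t) + (S - R) (p t) -
          ContinuousLinearMap.adjoint B (p' (t + σ) - p (t + σ)) -
          ContinuousLinearMap.adjoint B (p (t + σ) - p (t + τ)) - (y t - x t) := by
        have e1 : q t = R (p t) - (ContinuousLinearMap.adjoint B (p (t + τ)) + x t - xd t) := by
          rw [← h1]; abel
        have e2 : q' t = S (p' t) - (ContinuousLinearMap.adjoint B (p' (t + σ)) + y t - xd t) := by
          rw [← h2]; abel
        rw [e1, e2, map_sub, map_sub, map_sub, sub_apply]
        abel
      have hSn : ‖S‖ ≤ L := by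
        rw [hS, LinearIsometryEquiv.norm_map]; exact hL t ht'
      have hSR : ‖S - R‖ ≤ ε := by
        rw [hS, hR, ← map_sub, LinearIsometryEquiv.norm_map]; exact hε t ht'
      have hBn : ‖ContinuousLinearMap.adjoint B‖ = ‖B‖ := LinearIsometryEquiv.norm_map _ _
      have a1 : ‖S (p' t - p t)‖ ≤ L * ‖p' t - p t‖ := S.le_of_opNorm_le hSn _
      have a2 : ‖(S - R) (p t)‖ ≤ ε * P :=
        ((S - R).le_of_opNorm_le hSR _).trans (by gcongr; exact hP t)
      have a3 := (ContinuousLinearMap.adjoint B).le_opNorm (p' (t + σ) - p (t + σ))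
      have a4 := (ContinuousLinearMap.adjoint B).le_opNorm (p (t + σ) - p (t + τ))
      rw [hBn] at a3 a4
      have a5 := hζ t ht'
      rw [h3]
      have b1 := _root_.norm_sub_le (S (p' t - p t) + (S - R) (p t) -
          ContinuousLinearMap.adjoint B (p' (t + σ) - p (t + σ)) -
          ContinuousLinearMap.adjoint B (p (t + σ) - p (t + τ))) (y t - x t)
      have b2 := _root_.norm_sub_le (S (p' t - p t) + (S - R) (p t) -
          ContinuousLinearMap.adjoint B (p' (t + σ) - p (t + σ)))
          (ContinuousLinearMap.adjoint B (p (t + σ) - p (t + τ)))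
      have b3 := _root_.norm_sub_le (S (p' t - p t) + (S - R) (p t))
          (ContinuousLinearMap.adjoint B (p' (t + σ) - p (t + σ)))
      have b4 := norm_add_le (S (p' t - p t)) ((S - R) (p t))
      linarith
    have hrev : MeasurePreserving (fun t : ℝ => T - t) (volume.restrict (Ioo 0 T))
        (volume.restrict (Ioo 0 T)) := by
      have := (volume.measurePreserving_sub_left T).restrict_preimage
        (measurableSet_Ioo (a := (0 : ℝ)) (b := T))
      simpa using this
    filter_upwards [hrev.quasiMeasurePreserving.ae hae] with t ht
    have e0 : -q' (T - t) - -q (T - t) = -(q' (T - t) - q (T - t)) := by abel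
    rw [e0, norm_neg]
    refine ht.trans ?_
    have e1 : T - t + σ = T - (t - σ) := by ring
    have e2 : T - t + τ = T - (t - τ) := by ring
    rw [e1, e2]
    have e3 : 0 ≤ ‖B‖ * ‖p' (T - t) - p (T - t)‖ := by positivity
    have e4 : 0 ≤ L * ‖p' (T - (t - σ)) - p (T - (t - σ))‖ := by positivity
    linarith

/-- The duality identity: testing the adjoint equation with the difference of two states trades
that difference for the linearization error and for a translation of the perturbed state. -/
lemma IsLineAdjoint.integral_inner_sub (hx : IsLineState T B f g φ ψ τ x v)
    (hy : IsLineState T B f g φ ψ σ y w) (hp : IsLineAdjoint T B f xd τ x p q)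
    (hf : ContDiff ℝ 1 f) (hT : 0 ≤ T) (hτ : 0 ≤ τ)
    (hxd : IntervalIntegrable xd volume 0 T) :
    ∫ t in (0 : ℝ)..T, inner ℝ (x t - xd t) (y t - x t) =
      (∫ t in (0 : ℝ)..T,
        inner ℝ (p t) (fderiv ℝ f (x t) (y t - x t) - (f (y t) - f (x t)))) +
      ∫ t in (0 : ℝ)..T, inner ℝ (p t) (B (y (t - σ) - y (t - τ))) := by
  have hxc := hx.prim.continuous
  have hyc := hy.prim.continuous
  have hpc := hp.prim.continuous
  have hfc := hf.continuous
  have hdf : Continuous fun t => fderiv ℝ f (x t) :=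
    (hf.continuous_fderiv one_ne_zero).comp hxc
  have hz := hy.prim.sub hx.prim
  have hz0 : ∀ t ≤ 0, y t - x t = 0 := fun t ht => by
    rw [hx.initial t ht, hy.initial t ht, sub_self]
  have hprod := (hp.prim.isPrimitiveOn 0 T).integral_inner hT (hz.isPrimitiveOn 0 T)
  rw [hp.terminal T le_rfl, hz0 0 le_rfl, inner_zero_left, inner_zero_right, sub_zero] at hprod
  have hshift := integral_inner_shift B hτ hpc hz.continuous hp.terminal hz0
  have i1 : IntervalIntegrable (fun t => inner ℝ (p t)
      (fderiv ℝ f (x t) (y t - x t) - (f (y t) - f (x t)))) volume 0 T :=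
    Continuous.intervalIntegrable (by fun_prop) _ _
  have i2 : IntervalIntegrable (fun t => inner ℝ (p t) (B (y (t - σ) - y (t - τ)))) volume 0 T :=
    Continuous.intervalIntegrable (by fun_prop) _ _
  have i3 : IntervalIntegrable (fun t => inner ℝ (p t) (B (y (t - τ) - x (t - τ)))) volume 0 T :=
    Continuous.intervalIntegrable (by fun_prop) _ _
  have i4 : IntervalIntegrable (fun t => inner ℝ (p (t + τ)) (B (y t - x t))) volume 0 T :=
    Continuous.intervalIntegrable (by fun_prop) _ _
  have i5 : IntervalIntegrable (fun t => inner ℝ (x t - xd t) (y t - x t)) volume 0 T := by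
    have := intervalIntegrable_inner (hyc.sub hxc) ((hxc.intervalIntegrable 0 T).sub hxd)
    simpa only [real_inner_comm, Pi.sub_apply] using this
  have hae : ∫ t in (0 : ℝ)..T, (inner ℝ (p t) (w t - v t) + inner ℝ (q t) (y t - x t)) =
      ∫ t in (0 : ℝ)..T, ((((inner ℝ (p t)
        (fderiv ℝ f (x t) (y t - x t) - (f (y t) - f (x t))) +
        inner ℝ (p t) (B (y (t - σ) - y (t - τ)))) +
        inner ℝ (p t) (B (y (t - τ) - x (t - τ)))) -
        inner ℝ (p (t + τ)) (B (y t - x t))) - inner ℝ (x t - xd t) (y t - x t)) := by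
    rw [intervalIntegral.integral_of_le hT, intervalIntegral.integral_of_le hT,
      integral_Ioc_eq_integral_Ioo, integral_Ioc_eq_integral_Ioo]
    refine integral_congr_ae ?_
    filter_upwards [hx.equation, hy.equation, hp.equation] with t h1 h2 h3
    have e1 : w t - v t = -(f (y t) - f (x t)) + B (y (t - σ) - y (t - τ)) +
        B (y (t - τ) - x (t - τ)) := by
      rw [eq_sub_of_add_eq h1, eq_sub_of_add_eq h2, map_sub, map_sub]
      abel
    have e2 : q t = ContinuousLinearMap.adjoint (fderiv ℝ f (x t)) (p t) -
        ContinuousLinearMap.adjoint B (p (t + τ)) - (x t - xd t) := by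
      have : q t = ContinuousLinearMap.adjoint (fderiv ℝ f (x t)) (p t) -
        (ContinuousLinearMap.adjoint B (p (t + τ)) + x t - xd t) := by rw [← h3]; abel
      rw [this]; abel
    rw [e1, e2]
    simp only [inner_sub_left (ContinuousLinearMap.adjoint (fderiv ℝ f (x t)) (p t) - _),
      inner_sub_left (ContinuousLinearMap.adjoint (fderiv ℝ f (x t)) (p t)),
      ContinuousLinearMap.adjoint_inner_left, inner_add_right, inner_neg_right,
      inner_sub_right (p t) (fderiv ℝ f (x t) _)]
    ring
  rw [hae, intervalIntegral.integral_sub (((i1.add i2).add i3).sub i4) i5,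
    intervalIntegral.integral_sub ((i1.add i2).add i3) i4,
    intervalIntegral.integral_add (i1.add i2) i3, intervalIntegral.integral_add i1 i2] at hprod
  linarith

end Stability

/-! ### Derivative of the cost -/

section Nonlinearity

variable {E : Type*} [NormedAddCommGroup E] [NormedSpace ℝ E] [FiniteDimensional ℝ E]
  {f : E → E}

lemma exists_norm_fderiv_le (hf : ContDiff ℝ 1 f) (R : ℝ) :
    ∃ L, 0 ≤ L ∧ ∀ y ∈ Metric.closedBall (0 : E) R, ‖fderiv ℝ f y‖ ≤ L := by
  have : ProperSpace E := FiniteDimensional.proper ℝ E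
  obtain ⟨L, hL⟩ := (isCompact_closedBall (0 : E) R).exists_bound_of_continuousOn
    (hf.continuous_fderiv one_ne_zero).continuousOn
  exact ⟨max L 0, le_max_right _ _, fun y hy => (hL y hy).trans (le_max_left _ _)⟩

omit [FiniteDimensional ℝ E] in
lemma norm_map_sub_le_of_fderiv_le (hf : ContDiff ℝ 1 f) {R L : ℝ}
    (hL : ∀ y ∈ Metric.closedBall (0 : E) R, ‖fderiv ℝ f y‖ ≤ L) {y z : E}
    (hy : ‖y‖ ≤ R) (hz : ‖z‖ ≤ R) : ‖f z - f y‖ ≤ L * ‖z - y‖ :=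
  (convex_closedBall (0 : E) R).norm_image_sub_le_of_norm_fderiv_le
    (fun _ _ => (hf.differentiable one_ne_zero).differentiableAt) hL
    (mem_closedBall_zero_iff.2 hy) (mem_closedBall_zero_iff.2 hz)

/-- On a bounded set the derivative is uniformly continuous, and hence the first-order Taylor
remainder is uniformly small. -/
lemma exists_uniform_taylor (hf : ContDiff ℝ 1 f) (R : ℝ) {ε : ℝ} (hε : 0 < ε) :
    ∃ δ > 0, ∀ y z : E, ‖y‖ ≤ R → ‖z‖ ≤ R → ‖z - y‖ ≤ δ →
      ‖fderiv ℝ f z - fderiv ℝ f y‖ ≤ ε ∧ ‖f z - f y - fderiv ℝ f y (z - y)‖ ≤ ε * ‖z - y‖ := by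
  have : ProperSpace E := FiniteDimensional.proper ℝ E
  have huc := (isCompact_closedBall (0 : E) R).uniformContinuousOn_of_continuous
    (hf.continuous_fderiv one_ne_zero).continuousOn
  rw [Metric.uniformContinuousOn_iff] at huc
  obtain ⟨δ, hδ, H⟩ := huc ε hε
  have key : ∀ y z : E, ‖y‖ ≤ R → ‖z‖ ≤ R → ‖z - y‖ ≤ δ / 2 →
      ‖fderiv ℝ f z - fderiv ℝ f y‖ ≤ ε := fun y z hy hz hzy => by
    rw [← dist_eq_norm]
    exact (H z (mem_closedBall_zero_iff.2 hz) y (mem_closedBall_zero_iff.2 hy)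
      (by rw [dist_eq_norm]; linarith)).le
  refine ⟨δ / 2, by positivity, fun y z hy hz hzy => ⟨key y z hy hz hzy, ?_⟩⟩
  refine Convex.norm_image_sub_le_of_norm_fderiv_le'
    (s := Metric.closedBall (0 : E) R ∩ Metric.closedBall y (δ / 2))
    (fun u _ => (hf.differentiable one_ne_zero).differentiableAt)
    (fun u hu => key y u hy (mem_closedBall_zero_iff.1 hu.1) (mem_closedBall_iff_norm.1 hu.2))
    ((convex_closedBall _ _).inter (convex_closedBall _ _))
    ⟨mem_closedBall_zero_iff.2 hy, Metric.mem_closedBall_self (by positivity)⟩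
    ⟨mem_closedBall_zero_iff.2 hz, mem_closedBall_iff_norm.2 hzy⟩

end Nonlinearity

section Derivative

open scoped Topology

lemma eventually_mul_abs_sub_le (K : ℝ) {ε : ℝ} (hε : 0 < ε) (s : Set ℝ) (τ : ℝ) :
    ∀ᶠ σ in 𝓝[s] τ, K * |σ - τ| ≤ ε := by
  have hc : Continuous fun σ : ℝ => K * |σ - τ| := by fun_prop
  have h := (hc.tendsto τ).mono_left (nhdsWithin_le_nhds (s := s))
  simp only [sub_self, abs_zero, mul_zero] at h
  exact (h.eventually (gt_mem_nhds hε)).mono fun σ hσ => hσ.le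

variable {E : Type*} [NormedAddCommGroup E] [InnerProductSpace ℝ E]

lemma abs_integral_inner_translate_le {a w : ℝ → E} (B : E →L[ℝ] E) {T α : ℝ} (hT : 0 ≤ T)
    (ha : ∀ t ∈ Icc 0 T, ‖a t‖ ≤ α) (hw : Integrable w) (r : ℝ) :
    |∫ t in (0 : ℝ)..T, inner ℝ (a t) (B (w (t - r)))| ≤ α * ‖B‖ * ∫ t, ‖w t‖ := by
  have hα : 0 ≤ α := (norm_nonneg _).trans (ha 0 ⟨le_rfl, hT⟩)
  have h1 : Integrable fun t => α * ‖B‖ * ‖w (t - r)‖ :=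
    (hw.comp_sub_right r).norm.const_mul _
  calc |∫ t in (0 : ℝ)..T, inner ℝ (a t) (B (w (t - r)))|
      ≤ ∫ t in (0 : ℝ)..T, α * ‖B‖ * ‖w (t - r)‖ := by
        rw [← Real.norm_eq_abs]
        refine intervalIntegral.norm_integral_le_of_norm_le hT (ae_of_all _ fun t ht => ?_)
          h1.intervalIntegrable
        refine (norm_inner_le_norm _ _).trans ?_
        rw [mul_assoc]
        gcongr
        · exact ha t (Ioc_subset_Icc_self ht)
        · exact B.le_opNorm _
    _ ≤ ∫ t, α * ‖B‖ * ‖w (t - r)‖ := by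
        rw [intervalIntegral.integral_of_le hT]
        exact setIntegral_le_integral h1 (ae_of_all _ fun t => by positivity)
    _ = α * ‖B‖ * ∫ t, ‖w t‖ := by
        rw [integral_const_mul, integral_sub_right_eq_self (fun t => ‖w t‖)]

lemma intervalIntegrable_norm_sub_sq {x xd : ℝ → E} {T : ℝ} (hx : Continuous x)
    (hxd : IntervalIntegrable xd volume 0 T)
    (hxd2 : IntervalIntegrable (fun t => ‖xd t‖ ^ 2) volume 0 T) :
    IntervalIntegrable (fun t => ‖x t - xd t‖ ^ 2) volume 0 T := by
  have h1 : IntervalIntegrable (fun t => ‖x t‖ ^ 2) volume 0 T :=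
    Continuous.intervalIntegrable (by fun_prop) _ _
  have := (h1.sub ((intervalIntegrable_inner hx hxd).const_mul 2)).add hxd2
  refine this.congr fun t _ => ?_
  exact (norm_sub_sq_real _ _).symm

variable [FiniteDimensional ℝ E]
  {b T R : ℝ} {B : E →L[ℝ] E} {f : E → E} {g φ ψ xd : ℝ → E} {x v p q : ℝ → ℝ → E}

/-- The state depends Lipschitz continuously on the delay, uniformly in time, and so does its
derivative in `L¹`. -/
lemma exists_state_lipschitz (hf : ContDiff ℝ 1 f) (hT : 0 ≤ T)
    (hx : ∀ τ ∈ Icc 0 b, IsLineState T B f g φ ψ τ (x τ) (v τ))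
    (hR : ∀ τ ∈ Icc 0 b, ∀ t ∈ Icc 0 T, ‖x τ t‖ ≤ R) {τ : ℝ} (hτ : τ ∈ Icc 0 b) :
    ∃ C, 0 ≤ C ∧ ∀ σ ∈ Icc 0 b, (∀ t ≤ T, ‖x σ t - x τ t‖ ≤ C * |σ - τ|) ∧
      ∫ t, ‖v σ t - v τ t‖ ≤ C * |σ - τ| := by
  obtain ⟨L, hL0, hL⟩ := exists_norm_fderiv_le hf R
  have hD : 0 ≤ ∫ r, ‖v τ r‖ := integral_nonneg fun _ => norm_nonneg _
  set D := ∫ r, ‖v τ r‖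
  set C₁ := ‖B‖ * D * Real.exp (2 * (L + ‖B‖) * T) with hC₁
  have hC₁0 : 0 ≤ C₁ := by positivity
  set C₂ := T * ((L + ‖B‖) * C₁) + ‖B‖ * D with hC₂
  have hC₂0 : 0 ≤ C₂ := by positivity
  refine ⟨C₁ + C₂, by positivity, fun σ hσ => ?_⟩
  have hLip : ∀ t ∈ Icc 0 T, ‖f (x σ t) - f (x τ t)‖ ≤ L * ‖x σ t - x τ t‖ := fun t ht =>
    norm_map_sub_le_of_fderiv_le hf hL (hR τ hτ t ht) (hR σ hσ t ht)
  have h1 : ∀ t ≤ T, ‖x σ t - x τ t‖ ≤ C₁ * |σ - τ| := fun t ht => by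
    refine ((hx τ hτ).norm_sub_le (hx σ hσ) hT hσ.1 hL0 hLip t ht).trans (le_of_eq ?_)
    rw [hC₁]; ring
  have h2 := (hx τ hτ).integral_norm_velocity_sub_le (hx σ hσ) hT hσ.1 hL0 hLip h1
  have habs : 0 ≤ |σ - τ| := abs_nonneg _
  refine ⟨fun t ht => (h1 t ht).trans (by gcongr; linarith), h2.trans ?_⟩
  calc T * ((L + ‖B‖) * (C₁ * |σ - τ|)) + ‖B‖ * (|σ - τ| * D) = C₂ * |σ - τ| := by
        rw [hC₂]; ring
    _ ≤ _ := by gcongr; linarith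

/-- The adjoint state depends continuously on the delay, uniformly in time. There is no rate, as
the derivative of `f` is merely continuous. -/
lemma eventually_adjoint_close (hf : ContDiff ℝ 1 f) (hT : 0 ≤ T)
    (hx : ∀ τ ∈ Icc 0 b, IsLineState T B f g φ ψ τ (x τ) (v τ))
    (hp : ∀ τ ∈ Icc 0 b, IsLineAdjoint T B f xd τ (x τ) (p τ) (q τ))
    (hR : ∀ τ ∈ Icc 0 b, ∀ t ∈ Icc 0 T, ‖x τ t‖ ≤ R) {τ : ℝ} (hτ : τ ∈ Icc 0 b)
    {ε : ℝ} (hε : 0 < ε) :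
    ∀ᶠ σ in 𝓝[Icc 0 b] τ, ∀ t ∈ Icc 0 T, ‖p σ t - p τ t‖ ≤ ε := by
  obtain ⟨L, hL0, hL⟩ := exists_norm_fderiv_le hf R
  obtain ⟨C, hC0, hC⟩ := exists_state_lipschitz hf hT hx hR hτ
  obtain ⟨P, hP⟩ := (hp τ hτ).prim.exists_bound
  have hP0 : 0 ≤ P := (norm_nonneg _).trans (hP 0)
  have hD : 0 ≤ ∫ r, ‖q τ r‖ := integral_nonneg fun _ => norm_nonneg _
  set D := ∫ r, ‖q τ r‖
  set X := Real.exp (2 * (L + ‖B‖) * T) with hX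
  have hX0 : 0 < X := Real.exp_pos _
  set η := ε / (2 * (T * P * X + 1)) with hη
  have hη0 : 0 < η := by positivity
  have hη1 : T * P * X * η ≤ ε / 2 := by
    rw [hη, ← mul_div_assoc, div_le_div_iff₀ (by positivity) two_pos]
    nlinarith
  obtain ⟨δ, hδ, hδH⟩ := exists_uniform_taylor hf R hη0
  filter_upwards [self_mem_nhdsWithin, eventually_mul_abs_sub_le C hδ (Icc 0 b) τ,
    eventually_mul_abs_sub_le ((T * C + ‖B‖ * D) * X) (half_pos hε) (Icc 0 b) τ]
    with σ hσ h1 h2 t ht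
  have h3 := (hp τ hτ).norm_sub_le (hp σ hσ) hT hσ.1 hL0 hP hη0.le
    (by positivity : 0 ≤ C * |σ - τ|)
    (fun s hs => hL _ (mem_closedBall_zero_iff.2 (hR σ hσ s hs)))
    (fun s hs => (hδH _ _ (hR τ hτ s hs) (hR σ hσ s hs) (((hC σ hσ).1 s hs.2).trans h1)).1)
    (fun s hs => (hC σ hσ).1 s hs.2) t ht
  refine h3.trans ?_
  calc (T * (η * P + C * |σ - τ|) + ‖B‖ * (|σ - τ| * D)) * X
      = T * P * X * η + (T * C + ‖B‖ * D) * X * |σ - τ| := by ring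
    _ ≤ ε := by linarith

/-- The pairing in the formula for the derivative of the cost depends continuously on the delay. -/
lemma continuousOn_integral_inner_velocity (hf : ContDiff ℝ 1 f) (hT : 0 ≤ T)
    (hx : ∀ τ ∈ Icc 0 b, IsLineState T B f g φ ψ τ (x τ) (v τ))
    (hp : ∀ τ ∈ Icc 0 b, IsLineAdjoint T B f xd τ (x τ) (p τ) (q τ))
    (hR : ∀ τ ∈ Icc 0 b, ∀ t ∈ Icc 0 T, ‖x τ t‖ ≤ R) :
    ContinuousOn (fun τ => ∫ t in (0 : ℝ)..T, inner ℝ (p τ t) (B (v τ (t - τ)))) (Icc 0 b) := by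
  intro τ hτ
  obtain ⟨C, hC0, hC⟩ := exists_state_lipschitz hf hT hx hR hτ
  obtain ⟨P, hP⟩ := (hp τ hτ).prim.exists_bound
  have hpc := (hp τ hτ).prim.continuous
  have hP0 : 0 ≤ P := (norm_nonneg _).trans (hP 0)
  have hvi := fun σ (hσ : σ ∈ Icc 0 b) => (hx σ hσ).prim.integrable
  have hD : 0 ≤ ∫ r, ‖v τ r‖ := integral_nonneg fun _ => norm_nonneg _
  set D := ∫ r, ‖v τ r‖ with hDdef
  have hH := (continuous_integral_inner_translate hT hpc
    (B.integrable_comp (hvi τ hτ))).continuousWithinAt (s := Icc 0 b) (x := τ)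
  have hsmall : Filter.Tendsto (fun σ => (∫ t in (0 : ℝ)..T, inner ℝ (p σ t) (B (v σ (t - σ)))) -
      ∫ t in (0 : ℝ)..T, inner ℝ (p τ t) (B (v τ (t - σ)))) (𝓝[Icc 0 b] τ) (𝓝 0) := by
    rw [Metric.tendsto_nhds]
    intro ε hε
    set η := ε / (4 * (‖B‖ * (D + 1) + 1)) with hη
    have hη0 : 0 < η := by positivity
    have hη1 : η * ‖B‖ * (D + 1) ≤ ε / 4 := by
      rw [hη, div_mul_eq_mul_div, div_mul_eq_mul_div, div_le_div_iff₀ (by positivity) (by norm_num)]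
      nlinarith
    filter_upwards [self_mem_nhdsWithin, eventually_adjoint_close hf hT hx hp hR hτ hη0,
      eventually_mul_abs_sub_le C one_pos (Icc 0 b) τ,
      eventually_mul_abs_sub_le (P * ‖B‖ * C) (by positivity : 0 < ε / 4) (Icc 0 b) τ]
      with σ hσ h1 h2 h3
    have hsub : Integrable fun t => v σ t - v τ t := (hvi σ hσ).sub (hvi τ hτ)
    have i0 : ∀ σ' ∈ Icc 0 b, ∀ ρ ∈ Icc 0 b, IntervalIntegrable
        (fun t => inner ℝ (p σ' t) (B (v ρ (t - σ)))) volume 0 T := fun σ' hσ' ρ hρ =>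
      intervalIntegrable_inner (hp σ' hσ').prim.continuous
        (B.integrable_comp ((hvi ρ hρ).comp_sub_right σ)).intervalIntegrable
    have hsplit : (∫ t in (0 : ℝ)..T, inner ℝ (p σ t) (B (v σ (t - σ)))) -
        ∫ t in (0 : ℝ)..T, inner ℝ (p τ t) (B (v τ (t - σ))) =
        (∫ t in (0 : ℝ)..T, inner ℝ (p σ t - p τ t) (B (v σ (t - σ)))) +
        ∫ t in (0 : ℝ)..T, inner ℝ (p τ t) (B (v σ (t - σ) - v τ (t - σ))) := by
      simp only [inner_sub_left, map_sub, inner_sub_right]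
      rw [intervalIntegral.integral_sub (i0 σ hσ σ hσ) (i0 τ hτ σ hσ),
        intervalIntegral.integral_sub (i0 τ hτ σ hσ) (i0 τ hτ τ hτ)]
      ring
    have hvD : ∫ t, ‖v σ t‖ ≤ D + 1 := by
      calc ∫ t, ‖v σ t‖ ≤ ∫ t, (‖v τ t‖ + ‖v σ t - v τ t‖) := by
            refine integral_mono (hvi σ hσ).norm ((hvi τ hτ).norm.add hsub.norm) fun t => ?_
            simpa using norm_add_le (v τ t) (v σ t - v τ t)
        _ = D + ∫ t, ‖v σ t - v τ t‖ := integral_add (hvi τ hτ).norm hsub.norm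
        _ ≤ D + 1 := by linarith [(hC σ hσ).2]
    have b1 := abs_integral_inner_translate_le B hT h1 (hvi σ hσ) σ
    have b2 := abs_integral_inner_translate_le B hT (fun t _ => hP t) hsub σ
    have b3 : P * ‖B‖ * ∫ t, ‖v σ t - v τ t‖ ≤ P * ‖B‖ * C * |σ - τ| := by
      rw [mul_assoc (P * ‖B‖)]
      gcongr
      exact (hC σ hσ).2
    have b4 : η * ‖B‖ * ∫ t, ‖v σ t‖ ≤ η * ‖B‖ * (D + 1) := by gcongr
    rw [Real.dist_eq, sub_zero, hsplit]
    refine (abs_add_le _ _).trans_lt ?_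
    linarith
  have := hsmall.add hH
  rw [zero_add] at this
  refine this.congr fun σ => ?_
  ring

/-- The exact increment of the cost, from the duality identity. The translation of the perturbed
state is split into that of the fixed state and that of the difference, and the latter is moved
onto the adjoint state. -/
lemma half_integral_norm_sq_sub (hf : ContDiff ℝ 1 f) (hT : 0 ≤ T)
    (hx : ∀ τ ∈ Icc 0 b, IsLineState T B f g φ ψ τ (x τ) (v τ))
    (hp : ∀ τ ∈ Icc 0 b, IsLineAdjoint T B f xd τ (x τ) (p τ) (q τ))
    (hxd : IntervalIntegrable xd volume 0 T)
    (hxd2 : IntervalIntegrable (fun t => ‖xd t‖ ^ 2) volume 0 T)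
    {σ τ : ℝ} (hτ : τ ∈ Icc 0 b) (hσ : σ ∈ Icc 0 b) :
    (1 / 2) * (∫ t in (0 : ℝ)..T, ‖x σ t - xd t‖ ^ 2) -
        (1 / 2) * (∫ t in (0 : ℝ)..T, ‖x τ t - xd t‖ ^ 2) =
      ((∫ t in (0 : ℝ)..T, inner ℝ (p τ t) (B (x τ (t - σ)))) -
        ∫ t in (0 : ℝ)..T, inner ℝ (p τ t) (B (x τ (t - τ)))) +
      ((1 / 2) * (∫ t in (0 : ℝ)..T, ‖x σ t - x τ t‖ ^ 2) +
        (∫ t in (0 : ℝ)..T, inner ℝ (p τ t)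
          (fderiv ℝ f (x τ t) (x σ t - x τ t) - (f (x σ t) - f (x τ t)))) +
        ∫ t in (0 : ℝ)..T, inner ℝ (p τ (t + σ) - p τ (t + τ)) (B (x σ t - x τ t))) := by
  have hdual := (hp τ hτ).integral_inner_sub (hx τ hτ) (hx σ hσ) hf hT hτ.1 hxd
  have hxc := (hx τ hτ).prim.continuous
  have hyc := (hx σ hσ).prim.continuous
  have hpc := (hp τ hτ).prim.continuous
  have hzc : Continuous fun t => x σ t - x τ t := hyc.sub hxc
  have hz0 : ∀ t ≤ 0, x σ t - x τ t = 0 := fun t ht => by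
    rw [(hx τ hτ).initial t ht, (hx σ hσ).initial t ht, sub_self]
  have e1 := integral_inner_shift B hτ.1 hpc hzc (hp τ hτ).terminal hz0
  have e2 := integral_inner_shift B hσ.1 hpc hzc (hp τ hτ).terminal hz0
  have ci : ∀ {h : ℝ → ℝ}, Continuous h → IntervalIntegrable h volume 0 T :=
    fun h => h.intervalIntegrable _ _
  have i1 : IntervalIntegrable (fun t => inner ℝ (x τ t - xd t) (x σ t - x τ t)) volume 0 T := by
    have := intervalIntegrable_inner hzc ((hxc.intervalIntegrable 0 T).sub hxd)
    simpa only [real_inner_comm, Pi.sub_apply] using this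
  have e3 : ∫ t in (0 : ℝ)..T, ‖x σ t - xd t‖ ^ 2 = (∫ t in (0 : ℝ)..T, ‖x τ t - xd t‖ ^ 2) +
      2 * (∫ t in (0 : ℝ)..T, inner ℝ (x τ t - xd t) (x σ t - x τ t)) +
      ∫ t in (0 : ℝ)..T, ‖x σ t - x τ t‖ ^ 2 := by
    have i2 := intervalIntegrable_norm_sub_sq hxc hxd hxd2
    rw [← intervalIntegral.integral_const_mul, ← intervalIntegral.integral_add i2
      (i1.const_mul 2), ← intervalIntegral.integral_add (i2.add (i1.const_mul 2))
      (ci (by fun_prop))]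
    refine intervalIntegral.integral_congr fun t _ => ?_
    rw [← norm_add_sq_real]
    congr 2
    abel
  have e4 : ∫ t in (0 : ℝ)..T, inner ℝ (p τ (t + σ) - p τ (t + τ)) (B (x σ t - x τ t)) =
      (∫ t in (0 : ℝ)..T, inner ℝ (p τ (t + σ)) (B (x σ t - x τ t))) -
      ∫ t in (0 : ℝ)..T, inner ℝ (p τ (t + τ)) (B (x σ t - x τ t)) := by
    rw [← intervalIntegral.integral_sub (ci (by fun_prop)) (ci (by fun_prop))]
    simp only [inner_sub_left]
  have e5 : ∫ t in (0 : ℝ)..T, inner ℝ (p τ t) (B (x σ (t - σ) - x σ (t - τ))) =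
      ((∫ t in (0 : ℝ)..T, inner ℝ (p τ t) (B (x τ (t - σ)))) -
        ∫ t in (0 : ℝ)..T, inner ℝ (p τ t) (B (x τ (t - τ)))) +
      ((∫ t in (0 : ℝ)..T, inner ℝ (p τ t) (B (x σ (t - σ) - x τ (t - σ)))) -
        ∫ t in (0 : ℝ)..T, inner ℝ (p τ t) (B (x σ (t - τ) - x τ (t - τ)))) := by
    simp only [map_sub, inner_sub_right]
    rw [intervalIntegral.integral_sub (ci (by fun_prop)) (ci (by fun_prop)),
      intervalIntegral.integral_sub (ci (by fun_prop)) (ci (by fun_prop)),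
      intervalIntegral.integral_sub (ci (by fun_prop)) (ci (by fun_prop))]
    ring
  rw [e4, e2, e1]
  linarith

/-- In `half_integral_norm_sq_sub` the bracket with the translation of the fixed state carries the
derivative; the three remaining integrals are `o(|σ - τ|)`. -/
lemma hasDerivWithinAt_half_integral_norm_sq (hf : ContDiff ℝ 1 f) (hT : 0 ≤ T)
    (hx : ∀ τ ∈ Icc 0 b, IsLineState T B f g φ ψ τ (x τ) (v τ))
    (hp : ∀ τ ∈ Icc 0 b, IsLineAdjoint T B f xd τ (x τ) (p τ) (q τ))
    (hR : ∀ τ ∈ Icc 0 b, ∀ t ∈ Icc 0 T, ‖x τ t‖ ≤ R)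
    (hxd : IntervalIntegrable xd volume 0 T)
    (hxd2 : IntervalIntegrable (fun t => ‖xd t‖ ^ 2) volume 0 T) {τ : ℝ} (hτ : τ ∈ Icc 0 b) :
    HasDerivWithinAt (fun τ => (1 / 2) * ∫ t in (0 : ℝ)..T, ‖x τ t - xd t‖ ^ 2)
      (-∫ t in (0 : ℝ)..T, inner ℝ (p τ t) (B (v τ (t - τ)))) (Icc 0 b) τ := by
  obtain ⟨C, hC0, hC⟩ := exists_state_lipschitz hf hT hx hR hτ
  obtain ⟨P, hP⟩ := (hp τ hτ).prim.exists_bound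
  have hP0 : 0 ≤ P := (norm_nonneg _).trans (hP 0)
  have hpc := (hp τ hτ).prim.continuous
  have hD : 0 ≤ ∫ r, ‖q τ r‖ := integral_nonneg fun _ => norm_nonneg _
  set D := ∫ r, ‖q τ r‖
  have hK := (hasDerivAt_integral_inner_translate hT hpc
    ((hx τ hτ).prim.clm B) τ).hasDerivWithinAt (s := Icc 0 b)
  set rem : ℝ → ℝ := fun σ => (1 / 2) * (∫ t in (0 : ℝ)..T, ‖x σ t - x τ t‖ ^ 2) +
        (∫ t in (0 : ℝ)..T, inner ℝ (p τ t)
          (fderiv ℝ f (x τ t) (x σ t - x τ t) - (f (x σ t) - f (x τ t)))) +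
        ∫ t in (0 : ℝ)..T, inner ℝ (p τ (t + σ) - p τ (t + τ)) (B (x σ t - x τ t)) with hrem
  have hrem0 : rem τ = 0 := by simp [hrem]
  have hremd : HasDerivWithinAt rem 0 (Icc 0 b) τ := by
    rw [hasDerivWithinAt_iff_isLittleO, Asymptotics.isLittleO_iff]
    intro c hc
    -- a tolerance for which the linearization error is at most `c / 2 * |σ - τ|`
    set η := c / (2 * (T * P * C + 1)) with hη
    have hη0 : 0 < η := by positivity
    have hη1 : T * P * C * η ≤ c / 2 := by
      rw [hη, ← mul_div_assoc, div_le_div_iff₀ (by positivity) two_pos]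
      nlinarith
    obtain ⟨δ, hδ, hδH⟩ := exists_uniform_taylor hf R hη0
    filter_upwards [self_mem_nhdsWithin, eventually_mul_abs_sub_le C hδ (Icc 0 b) τ,
      eventually_mul_abs_sub_le (1 / 2 * T * C ^ 2 + ‖B‖ * C * D) (half_pos hc) (Icc 0 b) τ]
      with σ hσ h1 h2
    set d := |σ - τ| with hd
    have hd0 : 0 ≤ d := abs_nonneg _
    have hz : ∀ t ≤ T, ‖x σ t - x τ t‖ ≤ C * d := (hC σ hσ).1
    have b1 : ‖∫ t in (0 : ℝ)..T, ‖x σ t - x τ t‖ ^ 2‖ ≤ (C * d) ^ 2 * |T - 0| := by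
      refine intervalIntegral.norm_integral_le_of_norm_le_const fun t ht => ?_
      rw [uIoc_of_le hT] at ht
      rw [norm_pow, norm_norm]
      exact pow_le_pow_left₀ (norm_nonneg _) (hz t ht.2) 2
    have b2 : ‖∫ t in (0 : ℝ)..T, inner ℝ (p τ t)
        (fderiv ℝ f (x τ t) (x σ t - x τ t) - (f (x σ t) - f (x τ t)))‖ ≤
        P * (η * (C * d)) * |T - 0| := by
      refine intervalIntegral.norm_integral_le_of_norm_le_const fun t ht => ?_
      rw [uIoc_of_le hT] at ht
      refine (norm_inner_le_norm _ _).trans ?_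
      gcongr
      · exact hP t
      · rw [norm_sub_rev]
        have ht' := Ioc_subset_Icc_self ht
        refine (hδH _ _ (hR τ hτ t ht') (hR σ hσ t ht') ((hz t ht.2).trans h1)).2.trans ?_
        gcongr
        exact hz t ht.2
    have b3 : ‖∫ t in (0 : ℝ)..T,
        inner ℝ (p τ (t + σ) - p τ (t + τ)) (B (x σ t - x τ t))‖ ≤
        ‖B‖ * (C * d) * (d * D) := by
      have h3 : ∫ t in (0 : ℝ)..T, ‖p τ (t + σ) - p τ (t + τ)‖ ≤ d * D := by
        have := (hp τ hτ).prim.integral_translate_le (-σ) (-τ) hT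
        rw [neg_sub_neg, abs_sub_comm] at this
        simpa only [sub_neg_eq_add] using this
      calc _ ≤ ∫ t in (0 : ℝ)..T, ‖B‖ * (C * d) * ‖p τ (t + σ) - p τ (t + τ)‖ := by
            refine intervalIntegral.norm_integral_le_of_norm_le hT (ae_of_all _ fun t ht => ?_)
              (Continuous.intervalIntegrable (by fun_prop) _ _)
            refine (norm_inner_le_norm _ _).trans ?_
            rw [mul_comm]
            gcongr
            exact (B.le_opNorm _).trans (by gcongr; exact hz t ht.2)
        _ ≤ _ := by
            rw [intervalIntegral.integral_const_mul]
            gcongr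
    rw [sub_zero, abs_of_nonneg hT] at b1 b2
    rw [hrem0, smul_zero, sub_zero, sub_zero, Real.norm_eq_abs (σ - τ), ← hd]
    have b4 : ‖rem σ‖ ≤ 1 / 2 * ((C * d) ^ 2 * T) + P * (η * (C * d)) * T +
        ‖B‖ * (C * d) * (d * D) := by
      refine (norm_add₃_le).trans ?_
      rw [norm_mul, Real.norm_of_nonneg (by norm_num : (0 : ℝ) ≤ 1 / 2)]
      gcongr
    refine b4.trans ?_
    have e1 := mul_le_mul_of_nonneg_right h2 hd0
    have e2 := mul_le_mul_of_nonneg_right hη1 hd0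
    linarith
  have hsum := (hK.add hremd).const_add ((1 / 2) * (∫ t in (0 : ℝ)..T, ‖x τ t - xd t‖ ^ 2) -
    ∫ t in (0 : ℝ)..T, inner ℝ (p τ t) (B (x τ (t - τ))))
  rw [add_zero] at hsum
  refine hsum.congr_of_mem (fun σ hσ => ?_) hτ
  have := half_integral_norm_sq_sub hf hT hx hp hxd hxd2 hτ hσ
  simp only [hrem, Pi.add_apply]
  linarith

end Derivative

/-! ### Uniqueness, and passage to the line -/

section PrimitiveTools

variable {E : Type*} [NormedAddCommGroup E] [NormedSpace ℝ E]

lemma IsPrimitiveOn.congr {u v u' v' : ℝ → E} {a b : ℝ} (h : IsPrimitiveOn u v a b) (hab : a ≤ b)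
    (hu : EqOn u' u (Icc a b)) (hv : EqOn v' v (Ioo a b)) : IsPrimitiveOn u' v' a b := by
  have hsub : ∀ s ∈ Icc a b, ∀ t ∈ Icc a b, uIoo s t ⊆ Ioo a b := fun s hs t ht =>
    Ioo_subset_Ioo (le_min hs.1 ht.1) (max_le hs.2 ht.2)
  refine ⟨h.1.congr_uIoo fun t ht =>
    (hv (hsub a ⟨le_rfl, hab⟩ b ⟨hab, le_rfl⟩ ht)).symm, fun s hs t ht => ?_⟩
  rw [hu hs, hu ht, h.2 s hs t ht]
  exact intervalIntegral.integral_congr_uIoo fun r hr => (hv (hsub s hs t ht hr)).symm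

lemma IsPrimitiveOn.trans {u v : ℝ → E} {a b c : ℝ} (hab : a ≤ b) (hbc : b ≤ c)
    (h : IsPrimitiveOn u v a b) (h' : IsPrimitiveOn u v b c) : IsPrimitiveOn u v a c := by
  refine isPrimitiveOn_of_left (h.1.trans h'.1) fun t ht => ?_
  rcases le_total t b with htb | htb
  · exact h.left ⟨ht.1, htb⟩
  · have hmem : t ∈ Icc b c := ⟨htb, ht.2⟩
    rw [h'.left hmem, h.left ⟨hab, le_rfl⟩, add_assoc,
      intervalIntegral.integral_add_adjacent_intervals h.1
        (intervalIntegrable_of_mem_Icc h'.1 ⟨le_rfl, hbc⟩ hmem)]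

lemma IsPrimitiveOn.reverse {u v : ℝ → E} {T : ℝ} (h : IsPrimitiveOn u v 0 T) :
    IsPrimitiveOn (fun t => u (T - t)) (fun t => -v (T - t)) 0 T := by
  refine ⟨?_, fun s hs t ht => ?_⟩
  · have := (h.1.comp_sub_left T).neg.symm
    rwa [sub_zero, sub_self] at this
  · rw [intervalIntegral.integral_neg, intervalIntegral.integral_comp_sub_left,
      ← h.2 (T - t) ⟨by linarith [ht.2], by linarith [ht.1]⟩ (T - s)
        ⟨by linarith [hs.2], by linarith [hs.1]⟩]
    abel

end PrimitiveTools

section Transfer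

variable {n : ℕ} {b T τ : ℝ} {A : Matrix (Fin n) (Fin n) ℝ}
  {f : EuclideanSpace ℝ (Fin n) → EuclideanSpace ℝ (Fin n)}
  {g φ xd x : ℝ → EuclideanSpace ℝ (Fin n)}

lemma adjoint_toEuclideanCLM (A : Matrix (Fin n) (Fin n) ℝ) :
    ContinuousLinearMap.adjoint (Matrix.toEuclideanCLM (𝕜 := ℝ) A) =
      Matrix.toEuclideanCLM (𝕜 := ℝ) A.transpose := by
  rw [← ContinuousLinearMap.star_eq_adjoint, ← map_star, Matrix.star_eq_conjTranspose,
    Matrix.conjTranspose_eq_transpose_of_trivial]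

/-- Every state extends to the line, with the history and the derivative outside `[0,T]` given
by `φ` alone. -/
lemma IsState.exists_isLineState (hT : 0 < T) (hφ : IsH1 (-b) 0 φ)
    (hτ : τ ∈ Icc 0 b) (hx : IsState b T A f g φ τ x) :
    ∃ y, IsLineState T (Matrix.toEuclideanCLM (𝕜 := ℝ) A) f g (fun t => φ (max (-b) t))
      (indicator (Ioo (-b) 0) (deriv φ)) τ y (indicator (Ioc (-b) T) (deriv x)) ∧
      EqOn y x (Icc (-b) T) := by
  have hb : 0 ≤ b := hτ.1.trans hτ.2
  have hb' : -b ≤ 0 := by linarith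
  have hdx : EqOn (deriv x) (deriv φ) (Ioo (-b) 0) := fun t ht => by
    refine Filter.EventuallyEq.deriv_eq ?_
    filter_upwards [Ioo_mem_nhds ht.1 ht.2] with s hs
    exact hx.initial s (Ioo_subset_Icc_self hs)
  have h1 : IsPrimitiveOn x (deriv x) (-b) 0 :=
    (hφ.isPrimitiveOn hb').congr hb' hx.initial hdx
  have h2 : IsPrimitiveOn x (deriv x) (-b) T := h1.trans hb' hT.le (hx.isH1.isPrimitiveOn hT.le)
  obtain ⟨y, hy, hyx, hyl, -⟩ := h2.exists_extension (by linarith)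
  refine ⟨y, ⟨hy, fun t ht => ?_, fun t ht => ?_, ?_⟩, hyx⟩
  · rcases le_total t (-b) with h | h
    · rw [hyl t h, max_eq_left h, hx.initial _ ⟨le_rfl, hb'⟩]
    · rw [hyx ⟨h, ht.trans hT.le⟩, max_eq_right h, hx.initial t ⟨h, ht⟩]
  · by_cases hmem : t ∈ Ioo (-b) 0
    · rw [indicator_of_mem hmem, indicator_of_mem (show t ∈ Ioc (-b) T from
        ⟨hmem.1, hmem.2.le.trans hT.le⟩), hdx hmem]
    · rw [indicator_of_notMem hmem, indicator_of_notMem]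
      rintro ⟨h3, h4⟩
      rcases ht with h5 | h5
      · exact hmem ⟨h3, h5⟩
      · exact absurd h4 (not_le.2 h5)
  · filter_upwards [hx.equation, self_mem_ae_restrict measurableSet_Ioo] with t h3 ht
    rw [indicator_of_mem (show t ∈ Ioc (-b) T from ⟨by linarith [ht.1], ht.2.le⟩),
      hyx ⟨by linarith [ht.1], ht.2.le⟩,
      hyx ⟨by linarith [ht.1, hτ.2], by linarith [ht.2, hτ.1]⟩, h3]

lemma IsAdjointState.exists_isLineAdjoint (hb : 0 < b) (hT : 0 < T)
    {p y : ℝ → EuclideanSpace ℝ (Fin n)} (hτ : τ ∈ Icc 0 b) (hp : IsAdjointState b T A f xd τ x p) (hyx : EqOn y x (Icc (-b) T)) :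
    ∃ r q, IsLineAdjoint T (Matrix.toEuclideanCLM (𝕜 := ℝ) A) f xd τ y r q ∧
      EqOn r p (Icc 0 (T + b)) := by
  obtain ⟨r, hr, hrp, -, hrr⟩ :=
    (hp.isH1.isPrimitiveOn (by linarith)).exists_extension (by linarith)
  refine ⟨r, _, ⟨hr, fun t ht => ?_, ?_⟩, hrp⟩
  · rcases le_total t (T + b) with h | h
    · rw [hrp ⟨hT.le.trans ht, h⟩, hp.terminal t ⟨ht, h⟩]
    · rw [hrr t h, hp.terminal _ ⟨by linarith, le_rfl⟩]
  · filter_upwards [hp.equation, self_mem_ae_restrict measurableSet_Ioo] with t h3 ht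
    rw [indicator_of_mem (show t ∈ Ioc 0 (T + b) from ⟨ht.1, by linarith [ht.2]⟩),
      hyx ⟨by linarith [ht.1], ht.2.le⟩, hrp ⟨ht.1.le, by linarith [ht.2]⟩,
      hrp ⟨by linarith [ht.1, hτ.1], by linarith [ht.2, hτ.2]⟩, adjoint_toEuclideanCLM, h3]

/-- The solution of the state equation is unique, as `f` is Lipschitz on the bounded set where two
given solutions live. -/
lemma IsState.eqOn (hT : 0 < T) (hf : ContDiff ℝ 1 f) (hφ : IsH1 (-b) 0 φ)
    (hτ : τ ∈ Icc 0 b) {x' : ℝ → EuclideanSpace ℝ (Fin n)} (hx : IsState b T A f g φ τ x)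
    (hx' : IsState b T A f g φ τ x') : EqOn x x' (Icc (-b) T) := by
  obtain ⟨y, hy, hyx⟩ := hx.exists_isLineState hT hφ hτ
  obtain ⟨y', hy', hyx'⟩ := hx'.exists_isLineState hT hφ hτ
  obtain ⟨R, hR⟩ := hy.prim.exists_bound
  obtain ⟨R', hR'⟩ := hy'.prim.exists_bound
  obtain ⟨L, hL0, hL⟩ := exists_norm_fderiv_le hf (max R R')
  have h := hy.norm_sub_le hy' hT.le hτ.1 hL0 fun t _ =>
    norm_map_sub_le_of_fderiv_le hf hL ((hR t).trans (le_max_left _ _))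
      ((hR' t).trans (le_max_right _ _))
  intro t ht
  have h1 := h t ht.2
  simp only [sub_self, abs_zero, zero_mul, mul_zero] at h1
  rw [← hyx ht, ← hyx' ht, ← sub_eq_zero.1 (norm_le_zero_iff.1 h1)]

lemma IsAdjointState.eqOn (hb : 0 < b) (hT : 0 < T) (hf : ContDiff ℝ 1 f) (hφ : IsH1 (-b) 0 φ)
    (hτ : τ ∈ Icc 0 b) (hx : IsState b T A f g φ τ x) {p p' : ℝ → EuclideanSpace ℝ (Fin n)}
    (hp : IsAdjointState b T A f xd τ x p) (hp' : IsAdjointState b T A f xd τ x p') :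
    EqOn p p' (Icc 0 (T + b)) := by
  obtain ⟨y, hy, hyx⟩ := hx.exists_isLineState hT hφ hτ
  obtain ⟨r, q, hr, hrp⟩ := hp.exists_isLineAdjoint hb hT hτ hyx
  obtain ⟨r', q', hr', hrp'⟩ := hp'.exists_isLineAdjoint hb hT hτ hyx
  obtain ⟨R, hR⟩ := hy.prim.exists_bound
  obtain ⟨P, hP⟩ := hr.prim.exists_bound
  obtain ⟨L, hL0, hL⟩ := exists_norm_fderiv_le hf R
  have h := hr.norm_sub_le hr' hT.le hτ.1 hL0 (ε := 0) (ζ := 0) hP le_rfl le_rfl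
    (fun t _ => hL _ (mem_closedBall_zero_iff.2 (hR t))) (fun t _ => by simp)
    (fun t _ => by simp)
  intro t ht
  rcases le_total t T with htT | htT
  · have h1 := h t ⟨ht.1, htT⟩
    simp only [sub_self, abs_zero, zero_mul, mul_zero, add_zero] at h1
    rw [← hrp ht, ← hrp' ht, ← sub_eq_zero.1 (norm_le_zero_iff.1 h1)]
  · rw [hp.terminal t ⟨htT, ht.2⟩, hp'.terminal t ⟨htT, ht.2⟩]

end Transfer

section Monotonicity

variable {E : Type*} [NormedAddCommGroup E] [InnerProductSpace ℝ E] {f : E → E} {l : ℝ}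

/-- The one-sided bound on the derivative, integrated along the ray through `y`. -/
lemma le_inner_map_self (hf : ContDiff ℝ 1 f)
    (hfl : ∀ y v : E, 0 ≤ inner ℝ (fderiv ℝ f y v + l • v) v) (y : E) :
    -(l * ‖y‖ ^ 2) - ‖f 0‖ * ‖y‖ ≤ inner ℝ (f y) y := by
  have hd : ∀ s : ℝ, HasDerivAt (fun s : ℝ => inner ℝ (f (s • y)) y)
      (inner ℝ (fderiv ℝ f (s • y) y) y) s := fun s => by
    have h1 : HasDerivAt (fun s : ℝ => s • y) y s := by
      simpa using (hasDerivAt_id s).smul_const y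
    have h2 := ((hf.differentiable one_ne_zero) (s • y)).hasFDerivAt.comp_hasDerivAt s h1
    simpa using h2.inner ℝ (hasDerivAt_const s y)
  have h1 := mul_sub_le_image_sub_of_le_deriv (C := -(l * ‖y‖ ^ 2))
    (fun s => (hd s).differentiableAt) (fun s => by
      rw [(hd s).deriv]
      have := hfl (s • y) y
      rw [inner_add_left, real_inner_smul_left, real_inner_self_eq_norm_sq] at this
      linarith) zero_le_one
  simp only [one_smul, zero_smul, sub_zero, mul_one] at h1
  have h2 := neg_le_of_abs_le (abs_real_inner_le_norm (f 0) y)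
  linarith

end Monotonicity

/-! ### Solvability of the state and adjoint equations -/

section Solvability

/-- The energy estimate gives one bound for all delays and all nonlinearities with the same
one-sided bound. -/
lemma exists_bound_of_delay_equation {E : Type*} [NormedAddCommGroup E] [InnerProductSpace ℝ E]
    [CompleteSpace E] {g φ : ℝ → E} {b T l : ℝ} (B : E →L[ℝ] E) (c : ℝ) (hT : 0 ≤ T)
    (hl : 0 ≤ l) (hφ : ContinuousOn φ (Icc (-b) 0))
    (hg : IntervalIntegrable (fun t => ‖g t‖ ^ 2) volume 0 T) :
    ∃ R > 0, ∀ τ ∈ Icc 0 b, ∀ F : E → E, (∀ y, -(l * ‖y‖ ^ 2) - c * ‖y‖ ≤ inner ℝ (F y) y) →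
      ∀ x v : ℝ → E, Continuous x → IsPrimitiveOn x v 0 T → (∀ t ∈ Icc (-b) 0, x t = φ t) →
      (∀ᵐ t ∂(volume.restrict (Ioo 0 T)), v t + F (x t) = B (x (t - τ)) + g t) →
      ∀ t ∈ Icc 0 T, ‖x t‖ ≤ R := by
  obtain ⟨M, hM⟩ := isCompact_Icc.exists_bound_of_continuousOn hφ
  set S := (M ^ 2 + (c ^ 2 * T + ∫ s in (0 : ℝ)..T, ‖g s‖ ^ 2) +
      (2 * l + 2 + ‖B‖) * (b * M ^ 2)) * Real.exp (2 * (2 * l + 2 + ‖B‖) * T)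
  refine ⟨√S + 1, by positivity, fun τ hτ F hF x v hx hxv hi heq t ht => ?_⟩
  have h := norm_sq_le_of_delay_equation hT hl hτ hx hxv hF
    (fun t ht => (hi t ht).symm ▸ hM t ht) hg heq t ht
  linarith [(le_abs_self ‖x t‖).trans (Real.abs_le_sqrt h)]

variable {n : ℕ} {b T l τ : ℝ} {A : Matrix (Fin n) (Fin n) ℝ}
  {f : EuclideanSpace ℝ (Fin n) → EuclideanSpace ℝ (Fin n)}
  {g φ xd x : ℝ → EuclideanSpace ℝ (Fin n)}

lemma _root_.Continuous.memLp_two_restrict_Ioo {h : ℝ → EuclideanSpace ℝ (Fin n)}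
    (hh : Continuous h) (a b : ℝ) : MemLp h 2 (volume.restrict (Ioo a b)) := by
  obtain ⟨C, hC⟩ := isCompact_Icc.exists_bound_of_continuousOn (s := Icc a b) hh.continuousOn
  refine MemLp.of_bound hh.aestronglyMeasurable C ?_
  filter_upwards [self_mem_ae_restrict measurableSet_Ioo] with t ht
  exact hC t (Ioo_subset_Icc_self ht)

lemma intervalIntegrable_of_memLp_two {h : ℝ → EuclideanSpace ℝ (Fin n)} {a b : ℝ} (hab : a ≤ b)
    (hh : MemLp h 2 (volume.restrict (Ioo a b))) : IntervalIntegrable h volume a b := by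
  rw [intervalIntegrable_iff_integrableOn_Ioo_of_le hab]
  exact hh.integrable (by norm_num)

lemma intervalIntegrable_norm_sq_of_memLp_two {h : ℝ → EuclideanSpace ℝ (Fin n)} {a b : ℝ}
    (hab : a ≤ b) (hh : MemLp h 2 (volume.restrict (Ioo a b))) :
    IntervalIntegrable (fun t => ‖h t‖ ^ 2) volume a b := by
  rw [intervalIntegrable_iff_integrableOn_Ioo_of_le hab]
  exact (memLp_two_iff_integrable_sq_norm hh.1).1 hh

/-- The primitive, extended by constants, of a function on `[0,T]`. -/
lemma exists_forcing_primitive {h : ℝ → EuclideanSpace ℝ (Fin n)} (hT : 0 ≤ T)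
    (hh : IntervalIntegrable h volume 0 T) :
    ∃ H : ℝ → EuclideanSpace ℝ (Fin n), Continuous H ∧ (∀ t ≤ 0, H t = 0) ∧
      ∀ t ∈ Icc 0 T, H t = ∫ s in (0 : ℝ)..t, h s := by
  have hp : IsPrimitiveOn (fun t => ∫ s in (0 : ℝ)..t, h s) h 0 T :=
    isPrimitiveOn_of_left hh fun t _ => by simp
  obtain ⟨H, hH, hHe, hHl, -⟩ := hp.exists_extension hT
  exact ⟨H, hH.continuous, fun t ht => by simp [hHl t ht], hHe⟩

/-- Solvability of the state equation. The nonlinearity is cut off outside a ball large enough for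
the energy estimate, so that the solution of the truncated problem never meets the cut-off. -/
lemma exists_isState (hT : 0 < T) (hl : 0 ≤ l) (hf : ContDiff ℝ 1 f)
    (hfl : ∀ y v : EuclideanSpace ℝ (Fin n), 0 ≤ inner ℝ (fderiv ℝ f y v + l • v) v)
    (hg : MemLp g 2 (volume.restrict (Ioo 0 T))) (hφ : IsH1 (-b) 0 φ) (hτ : τ ∈ Icc 0 b) :
    ∃ x, IsState b T A f g φ τ x := by
  have hb : 0 ≤ b := hτ.1.trans hτ.2
  have hb' : -b ≤ 0 := by linarith
  have hφc : ContinuousOn φ (Icc (-b) 0) := by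
    have := hφ.1.continuousOn
    rwa [uIcc_of_le hb'] at this
  set B := Matrix.toEuclideanCLM (𝕜 := ℝ) A with hB
  have hgi := intervalIntegrable_of_memLp_two hT.le hg
  obtain ⟨R, hR0, hR⟩ := exists_bound_of_delay_equation B ‖f 0‖ hT.le hl hφc
    (intervalIntegrable_norm_sq_of_memLp_two hT.le hg)
  let χ : ContDiffBump (0 : EuclideanSpace ℝ (Fin n)) := ⟨R, R + 1, hR0, by linarith⟩
  set F : EuclideanSpace ℝ (Fin n) → EuclideanSpace ℝ (Fin n) := fun y => χ y • f y with hF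
  have hFC : ContDiff ℝ 1 F := χ.contDiff.smul hf
  obtain ⟨K, hK⟩ : ∃ K, LipschitzWith K F :=
    ContDiff.lipschitzWith_of_hasCompactSupport χ.hasCompactSupport.smul_right hFC one_ne_zero
  have hFb : ∀ y, -(l * ‖y‖ ^ 2) - ‖f 0‖ * ‖y‖ ≤ inner ℝ (F y) y := fun y => by
    have h1 := le_inner_map_self hf hfl y
    have h2 : 0 ≤ l * ‖y‖ ^ 2 + ‖f 0‖ * ‖y‖ := by positivity
    rw [hF, real_inner_smul_left]
    nlinarith [χ.nonneg (x := y), χ.le_one (x := y),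
      mul_le_mul_of_nonneg_left h1 (χ.nonneg (x := y)),
      mul_le_mul_of_nonneg_right (χ.le_one (x := y)) h2]
  obtain ⟨H, hHc, hH0, hHT⟩ := exists_forcing_primitive hT.le hgi
  have hφe : Continuous (IccExtend hb' fun t : Icc (-b) 0 => φ t) :=
    (continuousOn_iff_continuous_domRestrict.1 hφc).Icc_extend'
  obtain ⟨u, huc, hu0, huT⟩ := exists_delay_solution (K := K + ‖B‖) (b := b) (T := T) (τ := τ)
    (G := fun _ y z => -F y + B z) (c := fun t => IccExtend hb' (fun t : Icc (-b) 0 => φ t) t + H t)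
    (by have := hFC.continuous; fun_prop)
    (fun _ y z y' z' => by
      have e : -F y + B z - (-F y' + B z') = -(F y - F y') + B (z - z') := by
        rw [map_sub]; abel
      have e1 := hK.norm_sub_le y y'
      have e2 := B.le_opNorm (z - z')
      have e3 : 0 ≤ (K : ℝ) * ‖z - z'‖ := by positivity
      have e4 : 0 ≤ ‖B‖ * ‖y - y'‖ := by positivity
      rw [e]
      refine (norm_add_le _ _).trans ?_
      rw [norm_neg]
      linarith)
    (hφe.add hHc) (by positivity) hb hT.le hτ.1
  have hinit : ∀ t ∈ Icc (-b) 0, u t = φ t := fun t ht => by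
    rw [hu0 t ht, hH0 t ht.2, add_zero, IccExtend_of_mem hb' _ ht]
  set v : ℝ → EuclideanSpace ℝ (Fin n) := fun s => (-F (u s) + B (u (s - τ))) + g s with hv
  have hGc : Continuous fun s => -F (u s) + B (u (s - τ)) := by
    have := hFC.continuous
    fun_prop
  have hprim : IsPrimitiveOn u v 0 T := by
    refine isPrimitiveOn_of_left ((hGc.intervalIntegrable _ _).add hgi) fun t ht => ?_
    rw [intervalIntegral.integral_add (hGc.intervalIntegrable _ _)
      (intervalIntegrable_of_mem_Icc hgi ⟨le_rfl, hT.le⟩ ht), huT t ht, hHT t ht,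
      IccExtend_of_right_le hb' _ ht.1, hinit 0 ⟨hb', le_rfl⟩]
    abel
  have heq : ∀ t, v t + F (u t) = B (u (t - τ)) + g t := fun t => by
    simp only [hv]
    generalize F (u t) = y
    abel
  have hbound := hR τ hτ F hFb u v huc hprim hinit (ae_of_all _ heq)
  have hFu : ∀ t ∈ Icc 0 T, F (u t) = f (u t) := fun t ht => by
    rw [hF]
    simp only
    rw [χ.one_of_mem_closedBall (mem_closedBall_zero_iff.2 (hbound t ht)), one_smul]
  obtain ⟨hH1, hder⟩ := hprim.isH1 hT.le ((hGc.memLp_two_restrict_Ioo 0 T).add hg)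
  refine ⟨u, huc.continuousOn, hH1, hinit, ?_⟩
  filter_upwards [hder, self_mem_ae_restrict measurableSet_Ioo] with t h1 ht
  rw [h1, ← hFu t (Ioo_subset_Icc_self ht), heq]

/-- Solvability of the adjoint equation: reversing time gives a linear delay equation with zero
history. -/
lemma exists_isAdjointState (hb : 0 < b) (hT : 0 < T) (hf : ContDiff ℝ 1 f)
    (hφ : IsH1 (-b) 0 φ) (hxd : MemLp xd 2 (volume.restrict (Ioo 0 T))) (hτ : τ ∈ Icc 0 b)
    (hx : IsState b T A f g φ τ x) : ∃ p, IsAdjointState b T A f xd τ x p := by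
  obtain ⟨y, hy, hyx⟩ := hx.exists_isLineState hT hφ hτ
  have hyc := hy.prim.continuous
  set D := ContinuousLinearMap.adjoint (Matrix.toEuclideanCLM (𝕜 := ℝ) A) with hD
  set S : ℝ → EuclideanSpace ℝ (Fin n) →L[ℝ] EuclideanSpace ℝ (Fin n) :=
    fun t => ContinuousLinearMap.adjoint (fderiv ℝ f (y t)) with hS
  have hSc : Continuous S := (LinearIsometryEquiv.continuous _).comp
    ((hf.continuous_fderiv one_ne_zero).comp hyc)
  obtain ⟨R, hR⟩ := hy.prim.exists_bound
  obtain ⟨L, hL0, hL⟩ := exists_norm_fderiv_le hf R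
  have hSL : ∀ t, ‖S t‖ ≤ L := fun t => by
    rw [hS]
    simp only [LinearIsometryEquiv.norm_map]
    exact hL _ (mem_closedBall_zero_iff.2 (hR t))
  have hh : MemLp (fun t => y t - xd t) 2 (volume.restrict (Ioo 0 T)) :=
    (hyc.memLp_two_restrict_Ioo 0 T).sub hxd
  have hhi : IntervalIntegrable (fun t => y (T - t) - xd (T - t)) volume 0 T := by
    have := ((intervalIntegrable_of_memLp_two hT.le hh).comp_sub_left T).symm
    rwa [sub_zero, sub_self] at this
  obtain ⟨H, hHc, hH0, hHT⟩ := exists_forcing_primitive hT.le hhi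
  obtain ⟨r, hrc, hr0, hrT⟩ := exists_delay_solution (K := L + ‖D‖) (b := b) (T := T) (τ := τ)
    (G := fun s y z => -S (T - s) y + D z) (c := H) (by fun_prop)
    (fun s y z y' z' => by
      have e : -S (T - s) y + D z - (-S (T - s) y' + D z') = -S (T - s) (y - y') + D (z - z') := by
        rw [map_sub, map_sub]; abel
      have e1 := (S (T - s)).le_of_opNorm_le (hSL _) (y - y')
      have e2 := D.le_opNorm (z - z')
      have e3 : 0 ≤ L * ‖z - z'‖ := by positivity
      have e4 : 0 ≤ ‖D‖ * ‖y - y'‖ := by positivity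
      rw [e]
      refine (norm_add_le _ _).trans ?_
      rw [norm_neg]
      linarith)
    hHc (by positivity) hb.le hT.le hτ.1
  have hGc : Continuous fun s => -S (T - s) (r s) + D (r (s - τ)) := by fun_prop
  have hprim : IsPrimitiveOn r (fun s => (-S (T - s) (r s) + D (r (s - τ))) +
      (y (T - s) - xd (T - s))) 0 T := by
    refine isPrimitiveOn_of_left ((hGc.intervalIntegrable _ _).add hhi) fun t ht => ?_
    rw [intervalIntegral.integral_add (hGc.intervalIntegrable _ _)
      (intervalIntegrable_of_mem_Icc hhi ⟨le_rfl, hT.le⟩ ht), hrT t ht, hHT t ht,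
      hr0 0 ⟨by linarith, le_rfl⟩, hH0 0 le_rfl]
    abel
  set p : ℝ → EuclideanSpace ℝ (Fin n) := fun t => r (T - t) with hp
  have hpc : Continuous p := by fun_prop
  have hpT : ∀ t ∈ Icc T (T + b), p t = 0 := fun t ht => by
    rw [hp]
    simp only
    rw [hr0 _ ⟨by linarith [ht.2], by linarith [ht.1]⟩, hH0 _ (by linarith [ht.1])]
  set q : ℝ → EuclideanSpace ℝ (Fin n) := indicator (Iio T) fun t =>
    (S t (p t) - D (p (t + τ))) - (y t - xd t) with hq
  have hp1 : IsPrimitiveOn p q 0 T := by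
    refine hprim.reverse.congr hT.le (fun t _ => rfl) fun t ht => ?_
    rw [hq, indicator_of_mem (show t ∈ Iio T from ht.2)]
    have e : T - t - τ = T - (t + τ) := by ring
    simp only [hp, sub_sub_cancel, e]
    abel
  have hp2 : IsPrimitiveOn p q T (T + b) := by
    have h0 : IsPrimitiveOn (fun _ => (0 : EuclideanSpace ℝ (Fin n))) (fun _ => 0) T (T + b) :=
      ⟨intervalIntegrable_const, fun s _ t _ => by simp⟩
    refine h0.congr (by linarith) hpT fun t ht => ?_
    exact indicator_of_notMem (show t ∉ Iio T from not_lt.2 ht.1.le) _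
  have hql : MemLp q 2 (volume.restrict (Ioo 0 (T + b))) := by
    rw [hq, memLp_indicator_iff_restrict measurableSet_Iio,
      Measure.restrict_restrict measurableSet_Iio]
    have hset : Iio T ∩ Ioo 0 (T + b) = Ioo 0 T := by
      ext t
      simp only [mem_inter_iff, mem_Iio, mem_Ioo]
      constructor
      · rintro ⟨h1, h2, -⟩; exact ⟨h2, h1⟩
      · rintro ⟨h1, h2⟩; exact ⟨h2, h1, by linarith⟩
    rw [hset]
    exact (Continuous.memLp_two_restrict_Ioo (by fun_prop) 0 T).sub hh
  obtain ⟨hH1, hder⟩ := (hp1.trans hT.le (by linarith) hp2).isH1 (by linarith) hql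
  refine ⟨p, hH1, hpT, ?_⟩
  filter_upwards [ae_restrict_of_ae_restrict_of_subset
    (Ioo_subset_Ioo_right (by linarith : T ≤ T + b)) hder,
    self_mem_ae_restrict measurableSet_Ioo] with t h1 ht
  rw [h1, hq, indicator_of_mem (show t ∈ Iio T from ht.2), ← adjoint_toEuclideanCLM, ← hD,
    ← hyx ⟨by linarith [ht.1], ht.2.le⟩]
  simp only [hS]
  abel

end Solvability

end DelayOpt

open DelayOpt in
theorem proposition4p2 (n : ℕ) (b T l : ℝ) (hb : 0 < b) (hT : 0 < T) (hl : 0 < l)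
    (A : Matrix (Fin n) (Fin n) ℝ)
    (f : EuclideanSpace ℝ (Fin n) → EuclideanSpace ℝ (Fin n)) (hf : ContDiff ℝ 1 f)
    (hfl : ∀ y v : EuclideanSpace ℝ (Fin n), 0 ≤ inner ℝ (fderiv ℝ f y v + l • v) v)
    (g φ xd : ℝ → EuclideanSpace ℝ (Fin n))
    (hg : MemLp g 2 (volume.restrict (Ioo 0 T)))
    (hφ : DelayOpt.IsH1 (-b) 0 φ)
    (hxd : MemLp xd 2 (volume.restrict (Ioo 0 T))) :
    -- for every delay, the state equation is uniquely solvable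
    (∀ τ ∈ Icc 0 b, (∃ x, DelayOpt.IsState b T A f g φ τ x) ∧
      ∀ x y, DelayOpt.IsState b T A f g φ τ x → DelayOpt.IsState b T A f g φ τ y →
        EqOn x y (Icc (-b) T)) ∧
    -- so is the adjoint equation
    (∀ τ ∈ Icc 0 b, ∀ x, DelayOpt.IsState b T A f g φ τ x →
      (∃ p, DelayOpt.IsAdjointState b T A f xd τ x p) ∧
      ∀ p q, DelayOpt.IsAdjointState b T A f xd τ x p →
        DelayOpt.IsAdjointState b T A f xd τ x q → EqOn p q (Icc 0 (T + b))) ∧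
    -- with `x τ` the state and `p τ` the adjoint state, the cost is continuously differentiable
    (∀ x p : ℝ → ℝ → EuclideanSpace ℝ (Fin n),
      (∀ τ ∈ Icc 0 b, DelayOpt.IsState b T A f g φ τ (x τ)) →
      (∀ τ ∈ Icc 0 b, DelayOpt.IsAdjointState b T A f xd τ (x τ) (p τ)) →
      ContDiffOn ℝ 1 (DelayOpt.cost T xd x) (Icc 0 b) ∧
      ∀ τ ∈ Icc 0 b,
        IntervalIntegrable (fun t => ‖x τ t - xd t‖ ^ 2) volume 0 T ∧
        IntervalIntegrable (fun t => inner ℝ (p τ t)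
          (Matrix.toEuclideanCLM (𝕜 := ℝ) A (deriv (x τ) (t - τ)))) volume 0 T ∧
        HasDerivWithinAt (DelayOpt.cost T xd x)
          (-∫ t in (0 : ℝ)..T, inner ℝ (p τ t)
            (Matrix.toEuclideanCLM (𝕜 := ℝ) A (deriv (x τ) (t - τ)))) (Icc 0 b) τ) := by
  refine ⟨fun τ hτ => ⟨exists_isState hT hl.le hf hfl hg hφ hτ, fun x y hx hy =>
    hx.eqOn hT hf hφ hτ hy⟩, fun τ hτ x hx => ⟨exists_isAdjointState hb hT hf hφ hxd hτ hx,
    fun p q hp hq => hp.eqOn hb hT hf hφ hτ hx hq⟩, fun x p hx hp => ?_⟩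
  have hb' : -b ≤ 0 := by linarith
  choose! y hy hyx using fun τ hτ => (hx τ hτ).exists_isLineState hT hφ hτ
  choose! r q hr hrp using fun τ hτ => (hp τ hτ).exists_isLineAdjoint hb hT hτ (hyx τ hτ)
  have hφc : ContinuousOn φ (Icc (-b) 0) := by
    have := hφ.1.continuousOn
    rwa [uIcc_of_le hb'] at this
  obtain ⟨R, -, hR⟩ := exists_bound_of_delay_equation (Matrix.toEuclideanCLM (𝕜 := ℝ) A) ‖f 0‖
    hT.le hl.le hφc (intervalIntegrable_norm_sq_of_memLp_two hT.le hg)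
  have hyR : ∀ τ ∈ Icc 0 b, ∀ t ∈ Icc 0 T, ‖y τ t‖ ≤ R := fun τ hτ =>
    hR τ hτ f (le_inner_map_self hf hfl) (y τ) _ (hy τ hτ).prim.continuous
      ((hy τ hτ).prim.isPrimitiveOn 0 T)
      (fun t ht => by rw [(hy τ hτ).initial t ht.2, max_eq_right ht.1]) (hy τ hτ).equation
  have hxdi := intervalIntegrable_of_memLp_two hT.le hxd
  have hxd2 := intervalIntegrable_norm_sq_of_memLp_two hT.le hxd
  have hcongr : ∀ τ ∈ Icc 0 b, EqOn (fun t => ‖y τ t - xd t‖ ^ 2)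
      (fun t => ‖x τ t - xd t‖ ^ 2) (Icc 0 T) := fun τ hτ t ht => by
    simp only [hyx τ hτ ⟨hb'.trans ht.1, ht.2⟩]
  have hpair : ∀ τ ∈ Icc 0 b, EqOn (fun t => inner ℝ (r τ t) (Matrix.toEuclideanCLM (𝕜 := ℝ) A
        (indicator (Ioc (-b) T) (deriv (x τ)) (t - τ))))
      (fun t => inner ℝ (p τ t) (Matrix.toEuclideanCLM (𝕜 := ℝ) A (deriv (x τ) (t - τ))))
      (uIoc 0 T) := fun τ hτ t ht => by
    rw [uIoc_of_le hT.le] at ht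
    simp only
    rw [indicator_of_mem (show t - τ ∈ Ioc (-b) T from
        ⟨by linarith [ht.1, hτ.2], by linarith [ht.2, hτ.1]⟩),
      hrp τ hτ ⟨ht.1.le, by linarith [ht.2]⟩]
  have hpairint : ∀ τ ∈ Icc 0 b, ∫ t in (0 : ℝ)..T, inner ℝ (r τ t)
        (Matrix.toEuclideanCLM (𝕜 := ℝ) A (indicator (Ioc (-b) T) (deriv (x τ)) (t - τ))) =
      ∫ t in (0 : ℝ)..T, inner ℝ (p τ t)
        (Matrix.toEuclideanCLM (𝕜 := ℝ) A (deriv (x τ) (t - τ))) := fun τ hτ =>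
    intervalIntegral.integral_congr_ae (ae_of_all _ fun t ht => hpair τ hτ ht)
  have hcost : ∀ τ ∈ Icc 0 b, cost T xd x τ =
      (1 / 2) * ∫ t in (0 : ℝ)..T, ‖y τ t - xd t‖ ^ 2 := fun τ hτ => by
    unfold cost
    congr 1
    refine (intervalIntegral.integral_congr ?_).symm
    rw [uIcc_of_le hT.le]
    exact hcongr τ hτ
  have hderiv : ∀ τ ∈ Icc 0 b, HasDerivWithinAt (cost T xd x)
      (-∫ t in (0 : ℝ)..T, inner ℝ (p τ t)
        (Matrix.toEuclideanCLM (𝕜 := ℝ) A (deriv (x τ) (t - τ)))) (Icc 0 b) τ := fun τ hτ => by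
    rw [← hpairint τ hτ]
    exact (hasDerivWithinAt_half_integral_norm_sq hf hT.le hy hr hyR hxdi hxd2 hτ).congr_of_mem
      hcost hτ
  refine ⟨?_, fun τ hτ => ⟨?_, ?_, hderiv τ hτ⟩⟩
  · rw [contDiffOn_one_iff_derivWithin (uniqueDiffOn_Icc hb)]
    refine ⟨fun τ hτ => (hderiv τ hτ).differentiableWithinAt, ?_⟩
    refine (continuousOn_integral_inner_velocity hf hT.le hy hr hyR).neg.congr fun τ hτ => ?_
    rw [(hderiv τ hτ).derivWithin (uniqueDiffOn_Icc hb τ hτ), ← hpairint τ hτ]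
    rfl
  · refine (intervalIntegrable_norm_sub_sq (hy τ hτ).prim.continuous hxdi hxd2).congr
      fun t ht => ?_
    rw [uIoc_of_le hT.le] at ht
    exact hcongr τ hτ (Ioc_subset_Icc_self ht)
  · refine (intervalIntegrable_inner (hr τ hτ).prim.continuous
      (((Matrix.toEuclideanCLM (𝕜 := ℝ) A).integrable_comp
        (hy τ hτ).prim.integrable).comp_sub_right τ).intervalIntegrable).congr fun t ht => ?_
    exact hpair τ hτ ht
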